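/- \textbf{Conventions.} Let $\mathbb B$ be a separable real Banach space with norm $\lVert\cdot\rVert$. For $1<r\le 2$, $\mathbb B$ is called $r$-smooth if there is an equivalent norm $\lVert\cdot\rVert'$ on $\mathbb B$ with \[\sup_{t>0}\ \sup_{\lVert x\rVert'=\lVert y\rVert'=1}\frac{\lVert x+ty\rVert'+\lVert x-ty\rVert'-2}{t^r}<\infty .\] For integers $m\ge 2$ and $n\ge 0$ let $\operatorname{Inc}^m_n=\{(i_1,\dots,i_m)\in\mathbb Z^m: 1\le i_1<\dots<i_m\le n\}$. Let $(\xi_i)_{i\in\mathbb Z}$ be an i.i.d. sequence of random variables with values in a measurable space $(S,\mathcal S)$. A measurable function $h\colon S^m\to\mathbb B$ is symmetric if $h(x_{\sigma(1)},\dots,x_{\sigma(m)})=h(x_1,\dots,x_m)$ for all permutations $\sigma$ and all $x_1,\dots,x_m\in S$. For $1\le d\le m$, a symmetric $h$ is degenerate of order $d$ with respect to $(\xi_i)$ if $h(\xi_1,\dots,\xi_m)$ is integrable, \[\mathbb E[h(\xi_1,\dots,\xi_m)\mid \xi_1,\dots,\xi_{d-1}]=0\ \text{a.s.}\quad\text{and}\quad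 \mathbb E\bigl\lVert \mathbb E[h(\xi_1,\dots,\xi_m)\mid \xi_1,\dots,\xi_d]\bigr\rVert\neq 0,\] where for $d=1$ the first condition reads $\mathbb E[h(\xi_1,\dots,\xi_m)]=0$. \textbf{Theorem.} Let $\mathbb B$ be a separable $r$-smooth Banach space with $1<r\le 2$, let $m\ge 2$ be an integer, and let $1<p\le r$ and $q\ge p$ be real. There is a constant $C=C(\mathbb B,m,p,q)>0$, depending only on $\mathbb B$, $m$, $p$ and $q$, such that the following holds. Let $(\xi_i)_{i\in\mathbb Z}$ be an i.i.d. sequence with values in a measurable space $(S,\mathcal S)$, let $h\colon S^m\to\mathbb B$ be measurable, symmetric and degenerate of order $d$ with respect to $(\xi_i)_{i\in\mathbb Z}$, where $1\le d\le m$, let $n\ge 0$ be an integer and $p_n\in[0,1]$, and let $(a_{n;\mathbf i})_{\mathbf i\in\operatorname{Inc}^m_n}$ be i.i.d. Bernoulli random variables with parameter $p_n$ (value $1$ with probability $p_n$, value $0$ with probability $1-p_n$), such that the family $(a_{n;\mathbf i})_{\mathbf i\in\operatorname{Inc}^m_n}$ is independent of $(\xi_i)_{i\ge 1}$. Then the incomplete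 $U$-statistic \[U^{\mathrm{inc}}_{m,n}(h)=\sum_{\mathbf i=(i_1,\dots,i_m)\in\operatorname{Inc}^m_n}a_{n;\mathbf i}\,h(\xi_{i_1},\dots,\xi_{i_m})\] satisfies \[\mathbb E\bigl\lVert U^{\mathrm{inc}}_{m,n}(h)\bigr\rVert^q\le C\Bigl(n^{q(m-d)+dq/p}\,p_n^{q}+n^{mq/p}\,p_n^{q/p}+n^m p_n\Bigr)\,\mathbb E\lVert h(\xi_1,\dots,\xi_m)\rVert^q ,\] where both expectations are understood in $[0,\infty]$, with $0\cdot\infty=0$. -/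

import Mathlib

open MeasureTheory ProbabilityTheory

namespace IncompleteUStat

/-- The set `Inc_n^m` of the tuples `(i_1, …, i_m)` of integers such that
`1 ≤ i_1 < ⋯ < i_m ≤ n`. -/
noncomputable def Inc (m n : ℕ) : Finset (Fin m → ℤ) :=
  {i ∈ Fintype.piFinset (fun _ : Fin m => Finset.Icc (1 : ℤ) (n : ℤ)) |
    ∀ j k : Fin m, j < k → i j < i k}

/-- The random vector `(ξ_1, …, ξ_k)`. -/
def firstVec {Ω S : Type*} (ξ : ℤ → Ω → S) (k : ℕ) : Ω → (Fin k → S) :=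
  fun ω j => ξ ((j : ℤ) + 1) ω

/-- The σ-algebra generated by `(ξ_1, …, ξ_k)`; it is trivial for `k = 0`. -/
abbrev firstSigma {Ω S : Type*} [MeasurableSpace S] (ξ : ℤ → Ω → S) (k : ℕ) : MeasurableSpace Ω :=
  MeasurableSpace.comap (firstVec ξ k) inferInstance

/-- A Banach space is `r`-smooth if, for some equivalent norm `N`, the quotients
`(N (x + t y) + N (x - t y) - 2) / t ^ r` are bounded above, uniformly in `t > 0` and in
`x`, `y` with `N x = N y = 1`. -/
def IsSmoothSpace (r : ℝ) (B : Type*) [NormedAddCommGroup B] [NormedSpace ℝ B] : Prop :=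
  ∃ N : Seminorm ℝ B,
    (∃ c C : ℝ, 0 < c ∧ 0 < C ∧ ∀ x : B, c * ‖x‖ ≤ N x ∧ N x ≤ C * ‖x‖) ∧
    ∃ K : ℝ, ∀ t : ℝ, 0 < t → ∀ x y : B, N x = 1 → N y = 1 →
      (N (x + t • y) + N (x - t • y) - 2) / t ^ r ≤ K

/-- `(ξ_i)` is an i.i.d. sequence of random variables. -/
def IsIID {Ω S : Type*} [MeasurableSpace Ω] [MeasurableSpace S]
    (μ : Measure Ω) (ξ : ℤ → Ω → S) : Prop :=
  (∀ i, Measurable (ξ i)) ∧ iIndepFun ξ μ ∧ ∀ i j, IdentDistrib (ξ i) (ξ j) μ μ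

/-- The kernel `h` is a symmetric function of its `m` arguments. -/
def IsSymmKernel {S B : Type*} {m : ℕ} (h : (Fin m → S) → B) : Prop :=
  ∀ (σ : Equiv.Perm (Fin m)) (x : Fin m → S), h (fun k => x (σ k)) = h x

/-- The symmetric kernel `h` is degenerate of order `d` with respect to `(ξ_i)`: the variable
`h(ξ_1, …, ξ_m)` is integrable, its conditional expectation given `ξ_1, …, ξ_{d-1}` vanishes
almost surely, and its conditional expectation given `ξ_1, …, ξ_d` does not. -/
def IsDegenerateOfOrder {Ω S B : Type*} [MeasurableSpace Ω] [MeasurableSpace S]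
    [NormedAddCommGroup B] [NormedSpace ℝ B] [CompleteSpace B]
    (μ : Measure Ω) (ξ : ℤ → Ω → S) {m : ℕ} (h : (Fin m → S) → B) (d : ℕ) : Prop :=
  Integrable (fun ω => h (firstVec ξ m ω)) μ ∧
  μ[fun ω => h (firstVec ξ m ω) | firstSigma ξ (d - 1)] =ᵐ[μ] 0 ∧
  ∫ ω, ‖(μ[fun ω' => h (firstVec ξ m ω') | firstSigma ξ d]) ω‖ ∂μ ≠ 0

/-- The incomplete `U`-statistic `∑_{i ∈ Inc_n^m} a_i h(ξ_{i_1}, …, ξ_{i_m})`. -/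
noncomputable def incompleteUStat {Ω S B : Type*} [NormedAddCommGroup B] [NormedSpace ℝ B]
    {m n : ℕ} (a : Inc m n → Ω → ℝ) (ξ : ℤ → Ω → S) (h : (Fin m → S) → B) (ω : Ω) : B :=
  ∑ i : Inc m n, a i ω • h (fun k => ξ (i.1 k) ω)

end IncompleteUStat

/-!
An `r`-smooth space carries, for `1 < p ≤ r` and `p ≤ q`, a potential `Φ` comparable to `‖·‖ ^ q`
whose expected increment along a centered step is at most of order
`E ‖step‖ ^ p * ‖x‖ ^ (q - p) + E ‖step‖ ^ q`; iterating it gives a Rosenthal inequality.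

Complete `U`-statistics are bounded by induction on the number of arguments. Averaging a kernel over
its first argument leaves a kernel with one argument fewer. For the centered remainder the
`U`-statistic is a martingale in the sample size, whose increments are complete `U`-statistics of
sections of the kernel. Each order of degeneracy gains a factor `n ^ (q / p - q)` over the bound
`n ^ (q * m)` of the triangle inequality.

For the incomplete statistic write `a_i = p_n + (a_i - p_n)`. The first part is `p_n` times the
complete `U`-statistic. Given `ξ`, the second is a sum of independent centered vectors, to which the
Rosenthal inequality applies.
-/

namespace IncompleteUStat

open scoped ENNReal NNReal

section RealInequalities

variable {p q : ℝ}

lemma tangent_le_rpow (hq : 1 < q) {a s : ℝ} (ha : 0 ≤ a) (hs : 0 ≤ s) :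
    a ^ q + q * a ^ (q - 1) * (s - a) ≤ s ^ q := by
  rcases ha.eq_or_lt with rfl | ha
  · rw [Real.zero_rpow (by linarith), Real.zero_rpow (by linarith)]
    simpa using Real.rpow_nonneg hs q
  have bernoulli : 1 + q * (s / a - 1) ≤ (s / a) ^ q := by
    simpa using one_add_mul_self_le_rpow_one_add (s := s / a - 1)
      (by linarith [div_nonneg hs ha.le]) hq.le
  have a_rpow : a ^ q = a ^ (q - 1) * a := by
    rw [← Real.rpow_add_one ha.ne', sub_add_cancel]
  calc a ^ q + q * a ^ (q - 1) * (s - a) = (1 + q * (s / a - 1)) * a ^ q := by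
        rw [a_rpow]; field_simp
    _ ≤ (s / a) ^ q * a ^ q := by gcongr
    _ = s ^ q := by rw [← Real.mul_rpow (by positivity) ha.le, div_mul_cancel₀ _ ha.ne']

lemma sub_one_mul_rpow_sub_one_le (hq : 1 < q) {x : ℝ} (hx0 : 0 ≤ x) (hx2 : x ≤ 2) :
    (x - 1) * (x ^ (q - 1) - 1) ≤ q * 2 ^ (q - 1) * (x - 1) ^ 2 := by
  have one_le_two_rpow : (1 : ℝ) ≤ 2 ^ (q - 1) :=
    Real.one_le_rpow one_le_two (by linarith)
  rcases le_total 1 x with hx | hx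
  · have rpow_le : x ^ (q - 1) ≤ x ^ q := Real.rpow_le_rpow_of_exponent_le hx (by linarith)
    have tangent := tangent_le_rpow hq hx0 zero_le_one
    rw [Real.one_rpow] at tangent
    calc (x - 1) * (x ^ (q - 1) - 1) ≤ (x - 1) * (q * x ^ (q - 1) * (x - 1)) := by
          gcongr
          linarith
      _ ≤ (x - 1) * (q * 2 ^ (q - 1) * (x - 1)) := by gcongr
      _ = q * 2 ^ (q - 1) * (x - 1) ^ 2 := by ring
  · have rpow_le : x ^ q ≤ x ^ (q - 1) :=
      Real.rpow_le_rpow_of_exponent_ge_of_imp hx0 hx (by linarith) fun _ h => by linarith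
    have tangent := tangent_le_rpow hq zero_le_one hx0
    rw [Real.one_rpow, Real.one_rpow, mul_one] at tangent
    calc (x - 1) * (x ^ (q - 1) - 1) ≤ (x - 1) * (q * (x - 1)) :=
          mul_le_mul_of_nonpos_left (by linarith) (by linarith)
      _ = q * 1 * (x - 1) ^ 2 := by ring
      _ ≤ q * 2 ^ (q - 1) * (x - 1) ^ 2 := by gcongr

lemma rpow_le_one_add_quadratic (hq : 1 < q) {x : ℝ} (hx0 : 0 ≤ x) (hx2 : x ≤ 2) :
    x ^ q ≤ 1 + q * (x - 1) + q ^ 2 * 2 ^ (q - 1) * (x - 1) ^ 2 := by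
  have tangent := tangent_le_rpow hq hx0 zero_le_one
  rw [Real.one_rpow] at tangent
  linear_combination tangent + q * sub_one_mul_rpow_sub_one_le hq hx0 hx2

lemma rpow_add_rpow_le_of_abs_sub_one_le (hp2 : p ≤ 2) (hq : 1 < q) {a b t K : ℝ}
    (ha : 0 ≤ a) (hb : 0 ≤ b) (ht1 : t ≤ 1) (hat : |a - 1| ≤ t) (hbt : |b - 1| ≤ t)
    (hab : a + b ≤ 2 + K * t ^ p) :
    a ^ q + b ^ q ≤ 2 + (q * K + 2 * (q ^ 2 * 2 ^ (q - 1))) * t ^ p := by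
  have ht0 : 0 ≤ t := (abs_nonneg _).trans hat
  have sq_le_rpow : t ^ 2 ≤ t ^ p := by
    rw [← Real.rpow_two]
    exact Real.rpow_le_rpow_of_exponent_ge_of_imp ht0 ht1 hp2 fun _ h => by linarith
  have quadratic_le : ∀ x : ℝ, 0 ≤ x → |x - 1| ≤ t →
      x ^ q ≤ 1 + q * (x - 1) + q ^ 2 * 2 ^ (q - 1) * t ^ p := fun x hx0 hxt => by
    refine (rpow_le_one_add_quadratic hq hx0 (by linarith [(abs_le.1 hxt).2])).trans ?_
    gcongr
    exact (sq_le_sq₀ (abs_nonneg _) ht0 |>.2 hxt).trans' (sq_abs _).ge |>.trans sq_le_rpow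
  linear_combination quadratic_le a ha hat + quadratic_le b hb hbt + q * hab

end RealInequalities

section SmoothNorm

variable {B : Type*} [NormedAddCommGroup B] [NormedSpace ℝ B] {p q r K : ℝ} {N : Seminorm ℝ B}

lemma seminorm_add_add_seminorm_sub_le
    (hK : ∀ t : ℝ, 0 < t → ∀ x y : B, N x = 1 → N y = 1 →
      (N (x + t • y) + N (x - t • y) - 2) / t ^ r ≤ K)
    {x y : B} (hx : 0 < N x) (hy : 0 < N y) :
    N (x + y) / N x + N (x - y) / N x ≤ 2 + K * (N y / N x) ^ r := by
  have ht : 0 < N y / N x := div_pos hy hx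
  have normalized : ∀ z, 0 < N z → N ((N z)⁻¹ • z) = 1 := fun z hz => by
    rw [map_smul_eq_mul, norm_inv, Real.norm_of_nonneg hz.le, inv_mul_cancel₀ hz.ne']
  have scaled : ∀ z, N ((N x)⁻¹ • z) = N z / N x := fun z => by
    rw [map_smul_eq_mul, norm_inv, Real.norm_of_nonneg hx.le, inv_mul_eq_div]
  have smul_y : (N y / N x) • (N y)⁻¹ • y = (N x)⁻¹ • y := by
    rw [smul_smul]; congr 1; field_simp
  have smooth := hK _ ht _ _ (normalized x hx) (normalized y hy)
  rw [div_le_iff₀ (Real.rpow_pos_of_pos ht r), smul_y, ← smul_add, ← smul_sub, scaled,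
    scaled] at smooth
  linarith

lemma seminorm_rpow_add_rpow_le_of_le (hpr : p ≤ r) (hr : r ≤ 2) (hp : 1 < p) (hpq : p ≤ q)
    (hK : ∀ t : ℝ, 0 < t → ∀ x y : B, N x = 1 → N y = 1 →
      (N (x + t • y) + N (x - t • y) - 2) / t ^ r ≤ K)
    {x y : B} (hy : 0 < N y) (hyx : N y ≤ N x) :
    N (x + y) ^ q + N (x - y) ^ q ≤
      2 * N x ^ q + (q * |K| + 2 * (q ^ 2 * 2 ^ (q - 1))) * (N x ^ (q - p) * N y ^ p) := by
  have hx : 0 < N x := hy.trans_le hyx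
  have ht1 : N y / N x ≤ 1 := (div_le_one hx).2 hyx
  have deviation : ∀ z, N (z - x) = N y → |N z / N x - 1| ≤ N y / N x := fun z hz => by
    rw [div_sub_one hx.ne', abs_div, abs_of_pos hx, ← hz]
    gcongr
    exact abs_sub_map_le_sub N z x
  have smooth : N (x + y) / N x + N (x - y) / N x ≤ 2 + |K| * (N y / N x) ^ p := by
    refine (seminorm_add_add_seminorm_sub_le hK hx hy).trans ?_
    gcongr 2 + ?_ * ?_
    · exact le_abs_self K
    · exact Real.rpow_le_rpow_of_exponent_ge (div_pos hy hx) ht1 hpr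
  have key := rpow_add_rpow_le_of_abs_sub_one_le (hpr.trans hr) (hp.trans_le hpq)
    (div_nonneg (apply_nonneg N _) hx.le) (div_nonneg (apply_nonneg N _) hx.le) ht1
    (deviation _ (by rw [add_sub_cancel_left]))
    (deviation _ (by rw [sub_sub_cancel_left, map_neg_eq_map])) smooth
  rw [Real.div_rpow (apply_nonneg N _) hx.le, Real.div_rpow (apply_nonneg N _) hx.le,
    Real.div_rpow hy.le hx.le, ← add_div, div_le_iff₀ (Real.rpow_pos_of_pos hx q)] at key
  refine key.trans_eq ?_
  rw [Real.rpow_sub hx]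
  ring

lemma seminorm_rpow_add_rpow_le_of_ge (hq : 0 ≤ q) {x y : B} (hxy : N x ≤ N y) :
    N (x + y) ^ q + N (x - y) ^ q ≤ 2 * 2 ^ q * N y ^ q := by
  have le_two_mul : ∀ z, N z ≤ N x + N y → N z ^ q ≤ 2 ^ q * N y ^ q := fun z hz => by
    rw [← Real.mul_rpow zero_le_two (apply_nonneg N y)]
    exact Real.rpow_le_rpow (apply_nonneg N z) (by linarith) hq
  linear_combination le_two_mul _ (map_add_le_add N x y) + le_two_mul _ (map_sub_le_add N x y)

lemma exists_seminorm_rpow_add_rpow_le (hpr : p ≤ r) (hr : r ≤ 2) (hp : 1 < p) (hpq : p ≤ q)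
    (hK : ∀ t : ℝ, 0 < t → ∀ x y : B, N x = 1 → N y = 1 →
      (N (x + t • y) + N (x - t • y) - 2) / t ^ r ≤ K) :
    ∃ C : ℝ, 0 ≤ C ∧ ∀ x y : B, N (x + y) ^ q + N (x - y) ^ q ≤
      2 * N x ^ q + C * (N x ^ (q - p) * N y ^ p + N y ^ q) := by
  have hq : 0 < q := by linarith
  set c : ℝ := q * |K| + 2 * (q ^ 2 * 2 ^ (q - 1))
  have hc : 0 ≤ c := by positivity
  refine ⟨c + 2 * 2 ^ q, by positivity, fun x y => ?_⟩
  have rpow_nonneg : ∀ (z : B) (s : ℝ), 0 ≤ N z ^ s := fun z s =>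
    Real.rpow_nonneg (apply_nonneg N z) s
  have mixed_nonneg : 0 ≤ N x ^ (q - p) * N y ^ p := mul_nonneg (rpow_nonneg x _) (rpow_nonneg y _)
  have h2q : (0 : ℝ) ≤ 2 * 2 ^ q := by positivity
  rcases (apply_nonneg N y).eq_or_lt with hy | hy
  · have le_left : ∀ z, N z ≤ N x + N y → N z ^ q ≤ N x ^ q := fun z hz =>
      Real.rpow_le_rpow (apply_nonneg N z) (by linarith) hq.le
    nlinarith [le_left _ (map_add_le_add N x y), le_left _ (map_sub_le_add N x y),
      mul_nonneg (add_nonneg hc h2q) (add_nonneg mixed_nonneg (rpow_nonneg y q))]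
  rcases le_total (N y) (N x) with hyx | hxy
  · nlinarith [seminorm_rpow_add_rpow_le_of_le hpr hr hp hpq hK hy hyx,
      mul_nonneg h2q mixed_nonneg, mul_nonneg (add_nonneg hc h2q) (rpow_nonneg y q)]
  · nlinarith [seminorm_rpow_add_rpow_le_of_ge hq.le hxy, rpow_nonneg x q,
      mul_nonneg (add_nonneg hc h2q) mixed_nonneg, mul_nonneg hc (rpow_nonneg y q)]

end SmoothNorm

section Moments

variable {α : Type*} [MeasurableSpace α] {μ : Measure α} [IsProbabilityMeasure μ]

lemma lintegral_rpow_le_rpow_lintegral {f : α → ℝ≥0∞} (hf : AEMeasurable f μ) {t : ℝ}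
    (h0 : 0 ≤ t) (h1 : t ≤ 1) : ∫⁻ x, f x ^ t ∂μ ≤ (∫⁻ x, f x ∂μ) ^ t := by
  simpa using ENNReal.lintegral_mul_norm_pow_le hf (aemeasurable_const (b := (1 : ℝ≥0∞))) h0
    (sub_nonneg.2 h1) (by ring)

lemma rpow_lintegral_le_lintegral_rpow {f : α → ℝ≥0∞} (hf : AEMeasurable f μ) {q : ℝ}
    (hq : 1 ≤ q) : (∫⁻ x, f x ∂μ) ^ q ≤ ∫⁻ x, f x ^ q ∂μ := by
  have hq0 : 0 < q := by linarith
  have root := lintegral_rpow_le_rpow_lintegral (hf.pow_const q) (inv_nonneg.2 hq0.le)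
    (inv_le_one_of_one_le₀ hq)
  simp only [ENNReal.rpow_rpow_inv hq0.ne'] at root
  exact (ENNReal.le_rpow_inv_iff hq0).1 root

variable {E : Type*} [NormedAddCommGroup E] {q : ℝ}

lemma enorm_add_rpow_le (hq : 1 ≤ q) (x y : E) :
    ‖x + y‖ₑ ^ q ≤ 2 ^ (q - 1) * (‖x‖ₑ ^ q + ‖y‖ₑ ^ q) :=
  (ENNReal.rpow_le_rpow (enorm_add_le x y) (by linarith)).trans
    (ENNReal.rpow_add_le_mul_rpow_add_rpow _ _ hq)

variable [NormedSpace ℝ E]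

lemma enorm_integral_rpow_le_lintegral {Y : α → E} (hY : AEStronglyMeasurable Y μ) (hq : 1 ≤ q) :
    ‖∫ x, Y x ∂μ‖ₑ ^ q ≤ ∫⁻ x, ‖Y x‖ₑ ^ q ∂μ :=
  (ENNReal.rpow_le_rpow (enorm_integral_le_lintegral_enorm Y) (by linarith)).trans
    (rpow_lintegral_le_lintegral_rpow hY.enorm hq)

lemma lintegral_enorm_sub_integral_rpow_le {Y : α → E} (hY : AEStronglyMeasurable Y μ)
    (hq : 1 ≤ q) :
    ∫⁻ x, ‖Y x - ∫ y, Y y ∂μ‖ₑ ^ q ∂μ ≤ 2 ^ q * ∫⁻ x, ‖Y x‖ₑ ^ q ∂μ := by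
  have : AEMeasurable (fun x => ‖Y x‖ₑ ^ q) μ := hY.enorm.pow_const q
  calc ∫⁻ x, ‖Y x - ∫ y, Y y ∂μ‖ₑ ^ q ∂μ
      ≤ ∫⁻ x, 2 ^ (q - 1) * (‖Y x‖ₑ ^ q + ‖∫ y, Y y ∂μ‖ₑ ^ q) ∂μ :=
        lintegral_mono fun x => by
          simpa only [sub_eq_add_neg, enorm_neg] using enorm_add_rpow_le hq (Y x) (-∫ y, Y y ∂μ)
    _ = 2 ^ (q - 1) * (∫⁻ x, ‖Y x‖ₑ ^ q ∂μ + ‖∫ y, Y y ∂μ‖ₑ ^ q) := by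
        rw [lintegral_const_mul'' _ (by fun_prop), lintegral_add_right _ measurable_const,
          lintegral_const, measure_univ, mul_one]
    _ ≤ 2 ^ (q - 1) * (∫⁻ x, ‖Y x‖ₑ ^ q ∂μ + ∫⁻ x, ‖Y x‖ₑ ^ q ∂μ) := by
        gcongr; exact enorm_integral_rpow_le_lintegral hY hq
    _ = 2 ^ q * ∫⁻ x, ‖Y x‖ₑ ^ q ∂μ := by
        rw [← two_mul, ← mul_assoc]
        nth_rw 2 [← ENNReal.rpow_one 2]
        rw [← ENNReal.rpow_add _ _ (by simp) (by simp), sub_add_cancel]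

end Moments

section Potential

variable {B : Type*} [NormedAddCommGroup B] [NormedSpace ℝ B] {p q : ℝ} {N : Seminorm ℝ B}

lemma continuous_of_seminorm_le {C : ℝ} (hN : ∀ x, N x ≤ C * ‖x‖) : Continuous N := by
  refine (LipschitzWith.of_le_add_mul' C fun x y => ?_).continuous
  rw [dist_eq_norm]
  have := map_add_le_add N y (x - y)
  rw [add_sub_cancel] at this
  exact this.trans (by gcongr; exact hN _)

lemma ofReal_seminorm_rpow_second_difference_le (hp : 0 ≤ p) (hpq : p ≤ q) {C : ℝ} (hC : 0 ≤ C)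
    {A : ℝ≥0∞} (hA : ∀ x, ENNReal.ofReal (N x) ≤ A * ‖x‖ₑ)
    (hN : ∀ x y : B, N (x + y) ^ q + N (x - y) ^ q ≤
      2 * N x ^ q + C * (N x ^ (q - p) * N y ^ p + N y ^ q)) (x y : B) :
    ENNReal.ofReal (N (x + y)) ^ q + ENNReal.ofReal (N (x - y)) ^ q ≤
      2 * ENNReal.ofReal (N x) ^ q +
        ENNReal.ofReal C * A ^ q * (‖x‖ₑ ^ (q - p) * ‖y‖ₑ ^ p + ‖y‖ₑ ^ q) := by
  have hq : 0 ≤ q := hp.trans hpq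
  have hqp : 0 ≤ q - p := sub_nonneg.2 hpq
  have nonneg : ∀ z, 0 ≤ N z := apply_nonneg N
  have rpow_le : ∀ (z : B) {s : ℝ}, 0 ≤ s → ENNReal.ofReal (N z) ^ s ≤ A ^ s * ‖z‖ₑ ^ s :=
    fun z s hs => (ENNReal.rpow_le_rpow (hA z) hs).trans_eq (ENNReal.mul_rpow_of_nonneg _ _ hs)
  calc ENNReal.ofReal (N (x + y)) ^ q + ENNReal.ofReal (N (x - y)) ^ q
      = ENNReal.ofReal (N (x + y) ^ q + N (x - y) ^ q) := by
        rw [ENNReal.ofReal_rpow_of_nonneg (nonneg _) hq,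
          ENNReal.ofReal_rpow_of_nonneg (nonneg _) hq,
          ENNReal.ofReal_add (by have := nonneg (x + y); positivity)
            (by have := nonneg (x - y); positivity)]
    _ ≤ ENNReal.ofReal (2 * N x ^ q + C * (N x ^ (q - p) * N y ^ p + N y ^ q)) :=
        ENNReal.ofReal_le_ofReal (hN x y)
    _ = 2 * ENNReal.ofReal (N x) ^ q + ENNReal.ofReal C * (ENNReal.ofReal (N x) ^ (q - p) *
          ENNReal.ofReal (N y) ^ p + ENNReal.ofReal (N y) ^ q) := by
        have := nonneg x
        have := nonneg y
        simp only [ENNReal.ofReal_rpow_of_nonneg, nonneg, hp, hq, hqp]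
        rw [ENNReal.ofReal_add (by positivity) (by positivity), ENNReal.ofReal_mul zero_le_two,
          ENNReal.ofReal_mul hC, ENNReal.ofReal_add (by positivity) (by positivity),
          ENNReal.ofReal_mul (by positivity), ENNReal.ofReal_ofNat]
    _ ≤ 2 * ENNReal.ofReal (N x) ^ q + ENNReal.ofReal C * ((A ^ (q - p) * ‖x‖ₑ ^ (q - p)) *
          (A ^ p * ‖y‖ₑ ^ p) + A ^ q * ‖y‖ₑ ^ q) := by
        gcongr <;> exact rpow_le _ (by assumption)
    _ = 2 * ENNReal.ofReal (N x) ^ q +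
        ENNReal.ofReal C * A ^ q * (‖x‖ₑ ^ (q - p) * ‖y‖ₑ ^ p + ‖y‖ₑ ^ q) := by
        have A_rpow : A ^ q = A ^ (q - p) * A ^ p := by
          rw [← ENNReal.rpow_add_of_nonneg _ _ hqp hp, sub_add_cancel]
        rw [A_rpow]
        ring

variable [MeasurableSpace B]

/-- A function `Φ` comparable to `‖·‖ ^ q`, up to the factor `c`, whose mean grows in a controlled
way when a centered random vector is added to a fixed vector. It plays the part that `‖·‖ ^ 2` has
in a Hilbert space. -/
structure IsPotential (p q : ℝ) (Φ : B → ℝ≥0∞) (c : ℝ≥0∞) : Prop where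
  measurable : Measurable Φ
  one_le : 1 ≤ c
  ne_top : c ≠ ∞
  enorm_rpow_le : ∀ x, ‖x‖ₑ ^ q ≤ c * Φ x
  le_enorm_rpow : ∀ x, Φ x ≤ c * ‖x‖ₑ ^ q
  lintegral_add_le : ∀ (ρ : Measure B) [IsProbabilityMeasure ρ], Integrable id ρ →
    ∫ y, y ∂ρ = 0 → ∀ x, ∫⁻ y, Φ (x + y) ∂ρ ≤
      Φ x + c * (‖x‖ₑ ^ (q - p) * ∫⁻ y, ‖y‖ₑ ^ p ∂ρ + ∫⁻ y, ‖y‖ₑ ^ q ∂ρ)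

variable [BorelSpace B]

lemma ofReal_seminorm_rpow_le_lintegral_sub [CompleteSpace B] {C : ℝ} (hN : ∀ x, N x ≤ C * ‖x‖)
    (hq : 1 ≤ q) (ρ : Measure B) [IsProbabilityMeasure ρ] (hint : Integrable id ρ)
    (hmean : ∫ y, y ∂ρ = 0) (x : B) :
    ENNReal.ofReal (N x) ^ q ≤ ∫⁻ y, ENNReal.ofReal (N (x - y)) ^ q ∂ρ := by
  have hNc : Continuous N := continuous_of_seminorm_le hN
  have hint_sub : Integrable (fun y => x - y) ρ := (integrable_const x).sub hint
  have hint_N : Integrable (fun y => N (x - y)) ρ := by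
    refine (hint_sub.norm.const_mul C).mono' (by fun_prop) (.of_forall fun y => ?_)
    rw [Real.norm_of_nonneg (apply_nonneg N _)]
    exact hN _
  have mean_sub : ∫ y, (x - y) ∂ρ = x := by
    rw [integral_sub (g := fun y => y) (integrable_const x) hint, integral_const, hmean]
    simp
  have jensen := N.convexOn.map_integral_le hNc.continuousOn isClosed_univ (by simp) hint_sub hint_N
  rw [mean_sub] at jensen
  calc ENNReal.ofReal (N x) ^ q ≤ (∫⁻ y, ENNReal.ofReal (N (x - y)) ∂ρ) ^ q := by
        rw [← ofReal_integral_eq_lintegral_ofReal hint_N (.of_forall fun y => apply_nonneg N _)]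
        gcongr
    _ ≤ ∫⁻ y, ENNReal.ofReal (N (x - y)) ^ q ∂ρ :=
        rpow_lintegral_le_lintegral_rpow (by fun_prop) hq

/- Since `E Φ (x - Y) ≥ Φ x` by convexity, averaging the bound on `Φ (x + Y) + Φ (x - Y) - 2 Φ x`
leaves a bound on `E Φ (x + Y) - Φ x`. -/
lemma lintegral_ofReal_seminorm_add_rpow_le [CompleteSpace B] {C : ℝ} (hN : ∀ x, N x ≤ C * ‖x‖)
    (hq : 1 ≤ q) {D : ℝ≥0∞}
    (hΦ : ∀ x y, ENNReal.ofReal (N (x + y)) ^ q + ENNReal.ofReal (N (x - y)) ^ q ≤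
      2 * ENNReal.ofReal (N x) ^ q + D * (‖x‖ₑ ^ (q - p) * ‖y‖ₑ ^ p + ‖y‖ₑ ^ q))
    (ρ : Measure B) [IsProbabilityMeasure ρ] (hint : Integrable id ρ)
    (hmean : ∫ y, y ∂ρ = 0) (x : B) :
    ∫⁻ y, ENNReal.ofReal (N (x + y)) ^ q ∂ρ ≤ ENNReal.ofReal (N x) ^ q +
      D * (‖x‖ₑ ^ (q - p) * ∫⁻ y, ‖y‖ₑ ^ p ∂ρ + ∫⁻ y, ‖y‖ₑ ^ q ∂ρ) := by
  have hNc : Continuous N := continuous_of_seminorm_le hN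
  set Φ : B → ℝ≥0∞ := fun z => ENNReal.ofReal (N z) ^ q
  have hΦm : Measurable Φ := by fun_prop
  have Φ_ne_top : Φ x ≠ ∞ :=
    ENNReal.rpow_ne_top_of_nonneg (by linarith) ENNReal.ofReal_ne_top
  refine (ENNReal.add_le_add_iff_right Φ_ne_top).1 ?_
  calc ∫⁻ y, Φ (x + y) ∂ρ + Φ x ≤ ∫⁻ y, Φ (x + y) ∂ρ + ∫⁻ y, Φ (x - y) ∂ρ := by
        gcongr
        exact ofReal_seminorm_rpow_le_lintegral_sub hN hq ρ hint hmean x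
    _ = ∫⁻ y, (Φ (x + y) + Φ (x - y)) ∂ρ := (lintegral_add_left (by fun_prop) _).symm
    _ ≤ ∫⁻ y, (2 * Φ x + D * (‖x‖ₑ ^ (q - p) * ‖y‖ₑ ^ p + ‖y‖ₑ ^ q)) ∂ρ :=
        lintegral_mono (hΦ x)
    _ = 2 * Φ x + D * (‖x‖ₑ ^ (q - p) * ∫⁻ y, ‖y‖ₑ ^ p ∂ρ + ∫⁻ y, ‖y‖ₑ ^ q ∂ρ) := by
        rw [lintegral_add_left measurable_const, lintegral_const, measure_univ, mul_one,
          lintegral_const_mul _ (by fun_prop), lintegral_add_left (by fun_prop),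
          lintegral_const_mul _ (by fun_prop)]
    _ = Φ x + D * (‖x‖ₑ ^ (q - p) * ∫⁻ y, ‖y‖ₑ ^ p ∂ρ + ∫⁻ y, ‖y‖ₑ ^ q ∂ρ) + Φ x := by ring

lemma IsSmoothSpace.exists_isPotential [CompleteSpace B] {r : ℝ} (hB : IsSmoothSpace r B)
    (hp : 1 < p) (hpr : p ≤ r) (hr : r ≤ 2) (hpq : p ≤ q) :
    ∃ (Φ : B → ℝ≥0∞) (c : ℝ≥0∞), IsPotential p q Φ c := by
  obtain ⟨N, ⟨c₀, C₀, hc₀, _, hN⟩, K, hK⟩ := hB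
  obtain ⟨C, hC, second_difference⟩ := exists_seminorm_rpow_add_rpow_le hpr hr hp hpq hK
  have hq : 0 ≤ q := by linarith
  set A : ℝ≥0∞ := ENNReal.ofReal (max 1 (max C₀ c₀⁻¹))
  set c : ℝ≥0∞ := A ^ q * (1 + ENNReal.ofReal C)
  have one_le_A : 1 ≤ A := ENNReal.one_le_ofReal.2 (le_max_left _ _)
  have N_le : ∀ x, ENNReal.ofReal (N x) ≤ A * ‖x‖ₑ := fun x => by
    rw [← ofReal_norm, ← ENNReal.ofReal_mul (by positivity)]
    refine ENNReal.ofReal_le_ofReal ((hN x).2.trans ?_)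
    gcongr
    exact (le_max_left _ _).trans (le_max_right _ _)
  have le_N : ∀ x, ‖x‖ₑ ≤ A * ENNReal.ofReal (N x) := fun x => by
    rw [← ofReal_norm, ← ENNReal.ofReal_mul (by positivity)]
    refine ENNReal.ofReal_le_ofReal (((le_inv_mul_iff₀ hc₀).2 (hN x).1).trans ?_)
    gcongr
    exact (le_max_right _ _).trans (le_max_right _ _)
  have rpow_le : ∀ {a b : ℝ≥0∞}, a ≤ A * b → a ^ q ≤ c * b ^ q := fun {a b} hab =>
    calc a ^ q ≤ (A * b) ^ q := by gcongr
      _ = A ^ q * b ^ q := ENNReal.mul_rpow_of_nonneg _ _ hq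
      _ ≤ c * b ^ q := by gcongr; exact le_mul_of_one_le_right' le_self_add
  refine ⟨fun x => ENNReal.ofReal (N x) ^ q, c, ?_, ?_, ?_, fun x => rpow_le (le_N x),
    fun x => rpow_le (N_le x), fun ρ _ hint hmean x => ?_⟩
  · have := continuous_of_seminorm_le fun x => (hN x).2
    fun_prop
  · exact one_le_mul (ENNReal.one_le_rpow one_le_A (by linarith)) le_self_add
  · exact ENNReal.mul_ne_top (ENNReal.rpow_ne_top_of_nonneg hq ENNReal.ofReal_ne_top)
      (by finiteness)
  · refine (lintegral_ofReal_seminorm_add_rpow_le (fun x => (hN x).2) (by linarith)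
      (ofReal_seminorm_rpow_second_difference_le (by linarith) hpq hC N_le second_difference)
      ρ hint hmean x).trans ?_
    gcongr
    calc ENNReal.ofReal C * A ^ q = A ^ q * ENNReal.ofReal C := mul_comm _ _
      _ ≤ A ^ q * (1 + ENNReal.ofReal C) := by gcongr; exact le_add_self

end Potential

section Recursion

lemma le_of_le_rpow_mul_add {s : ℝ} (hs : 0 < s) {U V W : ℝ≥0∞} (hU : U ≠ ∞)
    (h : U ≤ U ^ (1 - s⁻¹) * V + W) : U ≤ (2 * V) ^ s + 2 * W := by
  rcases eq_or_ne U 0 with rfl | hU0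
  · exact zero_le
  rcases le_total (U ^ (1 - s⁻¹) * V) W with hW | hW
  · calc U ≤ W + W := h.trans (by gcongr)
      _ = 2 * W := (two_mul W).symm
      _ ≤ (2 * V) ^ s + 2 * W := le_add_self
  have absorbed : U ^ (1 - s⁻¹) * U ^ s⁻¹ ≤ U ^ (1 - s⁻¹) * (2 * V) := by
    rw [← ENNReal.rpow_add _ _ hU0 hU, sub_add_cancel, ENNReal.rpow_one, mul_left_comm, two_mul]
    exact h.trans (by gcongr)
  have root_le : U ^ s⁻¹ ≤ 2 * V :=
    (ENNReal.mul_le_mul_iff_right (ENNReal.rpow_pos (pos_iff_ne_zero.2 hU0) hU).ne'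
      (ENNReal.rpow_ne_top_of_ne_zero hU0 hU)).1 absorbed
  exact ((ENNReal.rpow_inv_le_iff hs).1 root_le).trans le_self_add

variable {ι : Type*} [DecidableEq ι] {s : ℝ} {I : Finset ι} {u : Finset ι → ℝ≥0∞}
  {v w : ι → ℝ≥0∞}

lemma finset_recursion_ne_top (hs : 1 ≤ s) (h0 : u ∅ = 0)
    (hstep : ∀ i ∈ I, ∀ t ⊆ I, i ∉ t → u (insert i t) ≤ u t + (u t ^ (1 - s⁻¹) * v i + w i))
    (hv : ∑ i ∈ I, v i ≠ ∞) (hw : ∑ i ∈ I, w i ≠ ∞) {t : Finset ι} (ht : t ⊆ I) : u t ≠ ∞ := by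
  refine Finset.induction_on' (motive := fun t => u t ≠ ∞) t (by simp [h0])
    fun i t' hi ht' hit hut => ?_
  have hiI := ht hi
  have hvi : v i ≠ ∞ := fun h => hv (ENNReal.sum_eq_top.2 ⟨i, hiI, h⟩)
  have hwi : w i ≠ ∞ := fun h => hw (ENNReal.sum_eq_top.2 ⟨i, hiI, h⟩)
  have hpow : u t' ^ (1 - s⁻¹) ≠ ∞ :=
    ENNReal.rpow_ne_top_of_nonneg (sub_nonneg.2 (inv_le_one_of_one_le₀ hs)) hut
  exact ne_top_of_le_ne_top (by finiteness) (hstep i hiI t' (ht'.trans ht) hit)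

/- The recursion is summed with the largest value of `u` on the right-hand side, which is then
absorbed into the left-hand side. -/
lemma finset_recursion_le (hs : 1 ≤ s) (h0 : u ∅ = 0)
    (hstep : ∀ i ∈ I, ∀ t ⊆ I, i ∉ t → u (insert i t) ≤ u t + (u t ^ (1 - s⁻¹) * v i + w i)) :
    u I ≤ (2 * ∑ i ∈ I, v i) ^ s + 2 * ∑ i ∈ I, w i := by
  have hs0 : 0 < s := by linarith
  have hexp : 0 ≤ 1 - s⁻¹ := sub_nonneg.2 (inv_le_one_of_one_le₀ hs)
  by_cases hv : ∑ i ∈ I, v i = ∞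
  · simp [hv, ENNReal.top_rpow_of_pos hs0]
  by_cases hw : ∑ i ∈ I, w i = ∞
  · simp [hw]
  set U := I.powerset.sup u
  have le_U : ∀ t ⊆ I, u t ≤ U := fun t ht => Finset.le_sup (Finset.mem_powerset.2 ht)
  have U_ne_top : U ≠ ∞ := by
    rw [← lt_top_iff_ne_top, Finset.sup_lt_iff ENNReal.zero_lt_top]
    exact fun t ht => (finset_recursion_ne_top hs h0 hstep hv hw (Finset.mem_powerset.1 ht)).lt_top
  have summed : ∀ t ⊆ I, u t ≤ U ^ (1 - s⁻¹) * ∑ i ∈ t, v i + ∑ i ∈ t, w i := fun t ht => by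
    refine Finset.induction_on'
      (motive := fun t => u t ≤ U ^ (1 - s⁻¹) * ∑ i ∈ t, v i + ∑ i ∈ t, w i) t (by simp [h0])
      fun i t' hi ht' hit ih => ?_
    rw [Finset.sum_insert hit, Finset.sum_insert hit]
    calc u (insert i t') ≤ u t' + (u t' ^ (1 - s⁻¹) * v i + w i) :=
          hstep i (ht hi) t' (ht'.trans ht) hit
      _ ≤ (U ^ (1 - s⁻¹) * ∑ i ∈ t', v i + ∑ i ∈ t', w i) + (U ^ (1 - s⁻¹) * v i + w i) := by
          have := le_U t' (ht'.trans ht)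
          gcongr
      _ = U ^ (1 - s⁻¹) * (v i + ∑ i ∈ t', v i) + (w i + ∑ i ∈ t', w i) := by ring
  refine (le_U I subset_rfl).trans
    (le_of_le_rpow_mul_add hs0 U_ne_top (Finset.sup_le fun t ht => ?_))
  have ht := Finset.mem_powerset.1 ht
  exact (summed t ht).trans (by gcongr)

lemma finset_recursion_le_of_const (hs : 1 ≤ s) {C : ℝ≥0∞} (hC : 1 ≤ C) (h0 : u ∅ = 0)
    (hstep : ∀ i ∈ I, ∀ t ⊆ I, i ∉ t →
      u (insert i t) ≤ u t + C * (u t ^ (1 - s⁻¹) * v i + w i)) :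
    u I ≤ (2 * C) ^ s * ((∑ i ∈ I, v i) ^ s + ∑ i ∈ I, w i) := by
  have one_le : 1 ≤ 2 * C := hC.trans (le_mul_of_one_le_left' one_le_two)
  calc u I ≤ (2 * ∑ i ∈ I, C * v i) ^ s + 2 * ∑ i ∈ I, C * w i :=
        finset_recursion_le hs h0 fun i hi t ht hit =>
          (hstep i hi t ht hit).trans_eq (by ring)
    _ = (2 * C) ^ s * (∑ i ∈ I, v i) ^ s + (2 * C) ^ (1 : ℝ) * ∑ i ∈ I, w i := by
        rw [← Finset.mul_sum, ← Finset.mul_sum, ← mul_assoc, ← mul_assoc, ENNReal.rpow_one,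
          ENNReal.mul_rpow_of_nonneg _ _ (by linarith)]
    _ ≤ (2 * C) ^ s * ((∑ i ∈ I, v i) ^ s + ∑ i ∈ I, w i) := by
        rw [mul_add]
        gcongr

lemma nat_recursion_le {s : ℝ} (hs : 1 ≤ s) {C : ℝ≥0∞} (hC : 1 ≤ C) {u : ℕ → ℝ≥0∞} {v w : ℝ≥0∞}
    (h0 : u 0 = 0) {n : ℕ} (hstep : ∀ k < n, u (k + 1) ≤ u k + C * (u k ^ (1 - s⁻¹) * v + w)) :
    u n ≤ (2 * C) ^ s * ((n * v) ^ s + n * w) := by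
  have card_lt : ∀ i ∈ Finset.range n, ∀ t ⊆ Finset.range n, i ∉ t → t.card < n :=
    fun i hi t ht hit => by
      simpa using Finset.card_lt_card ((Finset.ssubset_iff_of_subset ht).2 ⟨i, hi, hit⟩)
  simpa using finset_recursion_le_of_const (I := Finset.range n) (u := fun t => u t.card)
    (v := fun _ => v) (w := fun _ => w) hs hC (by simpa using h0) fun i hi t ht hit => by
      simpa only [Finset.card_insert_of_notMem hit] using hstep _ (card_lt i hi t ht hit)

end Recursion

section Rosenthal

lemma lintegral_rpow_sub_mul_le {α : Type*} [MeasurableSpace α] {μ : Measure α} {p q : ℝ}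
    (hp : 0 < p) (hpq : p ≤ q) {f g : α → ℝ≥0∞} (hf : AEMeasurable f μ) (hg : AEMeasurable g μ) :
    ∫⁻ x, f x ^ (q - p) * g x ∂μ ≤
      (∫⁻ x, f x ^ q ∂μ) ^ (1 - p / q) * (∫⁻ x, g x ^ (q / p) ∂μ) ^ (p / q) := by
  have hq : 0 < q := hp.trans_le hpq
  have holder := ENNReal.lintegral_mul_norm_pow_le (hf.pow_const q) (hg.pow_const (q / p))
    (sub_nonneg.2 ((div_le_one hq).2 hpq)) (div_nonneg hp.le hq.le) (sub_add_cancel _ _)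
  have exp_f : q * (1 - p / q) = q - p := by field_simp
  have exp_g : q / p * (p / q) = 1 := by field_simp
  simpa only [← ENNReal.rpow_mul, exp_f, exp_g, ENNReal.rpow_one] using holder

lemma lintegral_indepFun_eq {Ω V Z : Type*} [MeasurableSpace Ω] [MeasurableSpace V]
    [MeasurableSpace Z] {μ : Measure Ω} [IsFiniteMeasure μ] {X : Ω → V} {Y : Ω → Z}
    (hXY : IndepFun X Y μ) (hX : AEMeasurable X μ) (hY : AEMeasurable Y μ)
    {F : V → Z → ℝ≥0∞} (hF : Measurable (Function.uncurry F)) :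
    ∫⁻ ω, F (X ω) (Y ω) ∂μ = ∫⁻ ω, ∫⁻ ω', F (X ω) (Y ω') ∂μ ∂μ := by
  calc ∫⁻ ω, F (X ω) (Y ω) ∂μ
      = ∫⁻ z, Function.uncurry F z ∂(μ.map X).prod (μ.map Y) := by
        rw [← hXY.map_prod_eq_prod_map_map hX hY, lintegral_map' hF.aemeasurable (hX.prodMk hY)]
        rfl
    _ = ∫⁻ x, ∫⁻ y, F x y ∂(μ.map Y) ∂(μ.map X) := lintegral_prod _ hF.aemeasurable
    _ = ∫⁻ ω, ∫⁻ ω', F (X ω) (Y ω') ∂μ ∂μ := by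
        rw [lintegral_map' hF.lintegral_prod_right.aemeasurable hX]
        refine lintegral_congr fun ω => ?_
        exact lintegral_map' (hF.comp measurable_prodMk_left).aemeasurable hY

variable {B : Type*} [NormedAddCommGroup B] [NormedSpace ℝ B] [MeasurableSpace B]
  {p q : ℝ} {Φ : B → ℝ≥0∞} {c : ℝ≥0∞}

lemma IsPotential.map_zero (hΦ : IsPotential p q Φ c) (hq : 0 < q) : Φ 0 = 0 := by
  simpa [ENNReal.zero_rpow_of_pos hq] using hΦ.le_enorm_rpow 0

lemma IsPotential.lintegral_enorm_rpow_le (hΦ : IsPotential p q Φ c) {X : Type*}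
    [MeasurableSpace X] {ρ : Measure X} (W : X → B) :
    ∫⁻ x, ‖W x‖ₑ ^ q ∂ρ ≤ c * ∫⁻ x, Φ (W x) ∂ρ := by
  rw [← lintegral_const_mul' _ _ hΦ.ne_top]
  exact lintegral_mono fun x => hΦ.enorm_rpow_le _

variable [BorelSpace B] [SecondCountableTopology B]

lemma IsPotential.lintegral_comp_add_le (hΦ : IsPotential p q Φ c) {T : Type*} [MeasurableSpace T]
    {ν : Measure T} [IsProbabilityMeasure ν] {Y : T → B} (hY : Integrable Y ν)
    (hmean : ∫ t, Y t ∂ν = 0) (x : B) :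
    ∫⁻ t, Φ (x + Y t) ∂ν ≤
      Φ x + c * (‖x‖ₑ ^ (q - p) * ∫⁻ t, ‖Y t‖ₑ ^ p ∂ν + ∫⁻ t, ‖Y t‖ₑ ^ q ∂ν) := by
  have hYm := hY.aemeasurable
  have := Measure.isProbabilityMeasure_map (μ := ν) hYm
  have hΦm := hΦ.measurable
  have law_le := hΦ.lintegral_add_le (ν.map Y)
    ((integrable_map_measure aestronglyMeasurable_id hYm).2 hY)
    ((integral_map hYm aestronglyMeasurable_id).trans hmean) x
  rwa [lintegral_map' (by fun_prop) hYm, lintegral_map' (by fun_prop) hYm,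
    lintegral_map' (by fun_prop) hYm] at law_le

lemma IsPotential.lintegral_add_centered_le (hΦ : IsPotential p q Φ c) (hp : 0 < p) (hpq : p ≤ q)
    {X T : Type*} [MeasurableSpace X] [MeasurableSpace T] {ρ : Measure X} {ν : Measure T}
    [IsProbabilityMeasure ν] {W : X → B} {D : X → T → B} (hW : AEMeasurable W ρ)
    (hD : AEMeasurable (Function.uncurry D) (ρ.prod ν))
    (hcentered : ∀ᵐ x ∂ρ, Integrable (D x) ν ∧ ∫ t, D x t ∂ν = 0) {v w : ℝ≥0∞}
    (hv : ∫⁻ x, (∫⁻ t, ‖D x t‖ₑ ^ p ∂ν) ^ (q / p) ∂ρ ≤ v ^ (q / p))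
    (hw : ∫⁻ x, ∫⁻ t, ‖D x t‖ₑ ^ q ∂ν ∂ρ ≤ w) :
    ∫⁻ x, ∫⁻ t, Φ (W x + D x t) ∂ν ∂ρ ≤ ∫⁻ x, Φ (W x) ∂ρ +
      c ^ 2 * ((∫⁻ x, Φ (W x) ∂ρ) ^ (1 - p / q) * v + w) := by
  have hq : 0 < q := hp.trans_le hpq
  have hexp : 0 ≤ 1 - p / q := sub_nonneg.2 ((div_le_one hq).2 hpq)
  have hΦW : AEMeasurable (fun x => Φ (W x)) ρ := hΦ.measurable.comp_aemeasurable hW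
  have hDp : AEMeasurable (fun x => ∫⁻ t, ‖D x t‖ₑ ^ p ∂ν) ρ :=
    (hD.enorm.pow_const p).lintegral_prod_right'
  have hDW : AEMeasurable (fun x => ‖W x‖ₑ ^ (q - p) * ∫⁻ t, ‖D x t‖ₑ ^ p ∂ν) ρ :=
    (hW.enorm.pow_const _).mul hDp
  set E := ∫⁻ x, Φ (W x) ∂ρ
  have mixed_le : ∫⁻ x, ‖W x‖ₑ ^ (q - p) * ∫⁻ t, ‖D x t‖ₑ ^ p ∂ν ∂ρ ≤
      c * (E ^ (1 - p / q) * v) := by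
    calc ∫⁻ x, ‖W x‖ₑ ^ (q - p) * ∫⁻ t, ‖D x t‖ₑ ^ p ∂ν ∂ρ
        ≤ (∫⁻ x, ‖W x‖ₑ ^ q ∂ρ) ^ (1 - p / q) * (v ^ (q / p)) ^ (p / q) := by
          refine (lintegral_rpow_sub_mul_le hp hpq hW.enorm hDp).trans ?_
          gcongr
      _ ≤ (c * E) ^ (1 - p / q) * v := by
          rw [← ENNReal.rpow_mul, div_mul_div_cancel₀ hp.ne', div_self hq.ne', ENNReal.rpow_one]
          gcongr
          exact hΦ.lintegral_enorm_rpow_le W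
      _ ≤ c ^ (1 : ℝ) * E ^ (1 - p / q) * v := by
          rw [ENNReal.mul_rpow_of_nonneg _ _ hexp]
          gcongr
          · exact hΦ.one_le
          · exact sub_le_self _ (div_nonneg hp.le hq.le)
      _ = c * (E ^ (1 - p / q) * v) := by rw [ENNReal.rpow_one, mul_assoc]
  calc ∫⁻ x, ∫⁻ t, Φ (W x + D x t) ∂ν ∂ρ
      ≤ ∫⁻ x, (Φ (W x) + c * (‖W x‖ₑ ^ (q - p) * ∫⁻ t, ‖D x t‖ₑ ^ p ∂ν
          + ∫⁻ t, ‖D x t‖ₑ ^ q ∂ν)) ∂ρ :=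
        lintegral_mono_ae (hcentered.mono fun x hx => hΦ.lintegral_comp_add_le hx.1 hx.2 _)
    _ = E + c * (∫⁻ x, ‖W x‖ₑ ^ (q - p) * ∫⁻ t, ‖D x t‖ₑ ^ p ∂ν ∂ρ
          + ∫⁻ x, ∫⁻ t, ‖D x t‖ₑ ^ q ∂ν ∂ρ) := by
        rw [lintegral_add_left' hΦW, lintegral_const_mul' _ _ hΦ.ne_top, lintegral_add_left' hDW]
    _ ≤ E + c * (c * (E ^ (1 - p / q) * v) + c * w) := by
        gcongr
        exact hw.trans (le_mul_of_one_le_left' hΦ.one_le)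
    _ = E + c ^ 2 * (E ^ (1 - p / q) * v + w) := by ring

/-- The constant in the Rosenthal-type inequalities obtained from a potential `Φ` comparable to
`‖·‖ ^ q` up to the factor `c`. -/
noncomputable def rosenthalConst (p q : ℝ) (c : ℝ≥0∞) : ℝ≥0∞ := c * (2 * c ^ 2) ^ (q / p)

lemma rosenthalConst_ne_top (hp : 0 ≤ p) (hq : 0 ≤ q) (hc : c ≠ ∞) : rosenthalConst p q c ≠ ∞ :=
  ENNReal.mul_ne_top hc (ENNReal.rpow_ne_top_of_nonneg (div_nonneg hq hp) (by finiteness))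

lemma IsPotential.lintegral_enorm_sum_rpow_le (hΦ : IsPotential p q Φ c) (hp : 0 < p) (hpq : p ≤ q)
    {Ω ι : Type*} [MeasurableSpace Ω] {μ : Measure Ω} [IsProbabilityMeasure μ]
    {Y : ι → Ω → B} (hindep : iIndepFun Y μ) (hint : ∀ i, Integrable (Y i) μ)
    (hmean : ∀ i, ∫ ω, Y i ω ∂μ = 0) (I : Finset ι) :
    ∫⁻ ω, ‖∑ i ∈ I, Y i ω‖ₑ ^ q ∂μ ≤ rosenthalConst p q c *
      ((∑ i ∈ I, ∫⁻ ω, ‖Y i ω‖ₑ ^ p ∂μ) ^ (q / p) + ∑ i ∈ I, ∫⁻ ω, ‖Y i ω‖ₑ ^ q ∂μ) := by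
  classical
  have hq : 0 < q := hp.trans_le hpq
  have hY : ∀ i, AEMeasurable (Y i) μ := fun i => (hint i).aemeasurable
  have hS : ∀ t : Finset ι, AEMeasurable (fun ω => ∑ i ∈ t, Y i ω) μ := fun t => by fun_prop
  have hΦm := hΦ.measurable
  have recursion : ∫⁻ ω, Φ (∑ i ∈ I, Y i ω) ∂μ ≤ (2 * c ^ 2) ^ (q / p) *
      ((∑ i ∈ I, ∫⁻ ω, ‖Y i ω‖ₑ ^ p ∂μ) ^ (q / p) + ∑ i ∈ I, ∫⁻ ω, ‖Y i ω‖ₑ ^ q ∂μ) := by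
    refine finset_recursion_le_of_const (u := fun t => ∫⁻ ω, Φ (∑ i ∈ t, Y i ω) ∂μ)
      ((one_le_div hp).2 hpq) (one_le_pow₀ hΦ.one_le) (by simp [hΦ.map_zero hq])
      fun i _ t _ hit => ?_
    have hindep_it : IndepFun (fun ω => ∑ j ∈ t, Y j ω) (Y i) μ := by
      simpa only [← Finset.sum_apply] using hindep.indepFun_finsetSum_of_notMem₀ hY hit
    simp only [Finset.sum_insert hit, inv_div, add_comm (Y i _)]
    rw [lintegral_indepFun_eq (F := fun x y => Φ (x + y)) hindep_it (hS t) (hY i)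
      (hΦm.comp measurable_add)]
    exact hΦ.lintegral_add_centered_le hp hpq (D := fun _ => Y i) (hS t) (hY i).comp_snd
      (.of_forall fun _ => ⟨hint i, hmean i⟩) (by simp) (by simp)
  calc ∫⁻ ω, ‖∑ i ∈ I, Y i ω‖ₑ ^ q ∂μ ≤ c * ∫⁻ ω, Φ (∑ i ∈ I, Y i ω) ∂μ :=
        hΦ.lintegral_enorm_rpow_le _
    _ ≤ _ := by
        rw [rosenthalConst, mul_assoc]
        gcongr

end Rosenthal

section KernelSum

open Classical in
/-- The sum of `h (x_{i_1}, …, x_{i_m})` over all `i_1 < ⋯ < i_m` in `Fin n`: the complete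
`U`-statistic, without normalization, at the sample `x`. -/
noncomputable def kernelSum {S B : Type*} [AddCommMonoid B] (m n : ℕ) (h : (Fin m → S) → B)
    (x : Fin n → S) : B :=
  ∑ f : Fin m → Fin n with StrictMono f, h (x ∘ f)

/-- The kernel in the last `m` arguments obtained by fixing the first argument. The increments of
`kernelSum` in the sample size are values of `kernelSum` at such sections. -/
def section₀ {S B : Type*} {m : ℕ} (h : (Fin (m + 1) → S) → B) (t : S) (y : Fin m → S) : B :=
  h (Fin.cons t y)

variable {S B : Type*} {m n : ℕ}

lemma exists_succ_comp_eq {ι : Type*} {f : ι → Fin (n + 1)} (hf : ∀ k, f k ≠ 0) :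
    ∃ g : ι → Fin n, Fin.succ ∘ g = f :=
  ⟨fun k => (f k).pred (hf k), funext fun _ => Fin.succ_pred _ _⟩

lemma strictMono_succ_comp_iff {ι : Type*} [Preorder ι] {g : ι → Fin n} :
    StrictMono (Fin.succ ∘ g) ↔ StrictMono g :=
  ⟨fun h _ _ hab => Fin.succ_lt_succ_iff.1 (h hab), fun h => (Fin.strictMono_succ).comp h⟩

lemma strictMono_cons_zero_succ_comp_iff {g : Fin m → Fin n} :
    StrictMono (Fin.cons 0 (Fin.succ ∘ g) : Fin (m + 1) → Fin (n + 1)) ↔ StrictMono g := by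
  refine ⟨fun h a b hab => ?_, fun h a b hab => ?_⟩
  · simpa using h (Fin.succ_lt_succ_iff.2 hab)
  · obtain ⟨b, rfl⟩ := Fin.exists_succ_eq_of_ne_zero hab.ne_bot
    induction a using Fin.cases with
    | zero => simp
    | succ a => simpa using h (Fin.succ_lt_succ_iff.1 hab)

variable [AddCommMonoid B]

open Classical in
lemma sum_strictMono_fin_succ (F : (Fin (m + 1) → Fin (n + 1)) → B) :
    ∑ f with StrictMono f, F f =
      ∑ g : Fin (m + 1) → Fin n with StrictMono g, F (Fin.succ ∘ g) +
        ∑ g : Fin m → Fin n with StrictMono g, F (Fin.cons 0 (Fin.succ ∘ g)) := by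
  rw [← Finset.sum_filter_add_sum_filter_not _ (fun f => f 0 ≠ 0)]
  congr 1 <;> symm
  · refine Finset.sum_nbij (Fin.succ ∘ ·) ?_ ?_ ?_ fun _ _ => rfl
    · simp +contextual [strictMono_succ_comp_iff]
    · exact ((Fin.succ_injective n).comp_left).injOn
    · intro f hf
      simp only [Finset.coe_filter, Finset.mem_filter, Finset.mem_univ, true_and,
        Set.mem_ofPred_eq] at hf
      obtain ⟨g, rfl⟩ := exists_succ_comp_eq fun k hk =>
        hf.2 (Fin.le_zero_iff.1 ((hf.1.monotone (Fin.zero_le k)).trans hk.le))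
      exact ⟨g, by simpa using strictMono_succ_comp_iff.1 hf.1, rfl⟩
  · refine Finset.sum_nbij (fun g => Fin.cons 0 (Fin.succ ∘ g)) ?_ ?_ ?_ fun _ _ => rfl
    · simp +contextual [strictMono_cons_zero_succ_comp_iff]
    · exact ((Fin.cons_right_injective _).comp (Fin.succ_injective n).comp_left).injOn
    · intro f hf
      simp only [Finset.coe_filter, Finset.mem_filter, Finset.mem_univ, true_and,
        Set.mem_ofPred_eq, not_not] at hf
      obtain ⟨g, hg⟩ := exists_succ_comp_eq (f := Fin.tail f) fun k hk =>
        (hf.1 (Fin.succ_pos k)).ne (hf.2.trans hk.symm)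
      obtain rfl : Fin.cons 0 (Fin.succ ∘ g) = f := by
        rw [hg, ← hf.2, Fin.cons_self_tail]
      exact ⟨g, by simpa using strictMono_cons_zero_succ_comp_iff.1 hf.1, rfl⟩

lemma kernelSum_zero_left (h : (Fin 0 → S) → B) (x : Fin n → S) :
    kernelSum 0 n h x = h default := by
  rw [kernelSum, Finset.filter_true_of_mem fun f _ => Subsingleton.strictMono f, Fintype.sum_unique]
  exact congrArg h (Subsingleton.elim _ _)

lemma kernelSum_succ_zero (h : (Fin (m + 1) → S) → B) (x : Fin 0 → S) :
    kernelSum (m + 1) 0 h x = 0 :=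
  Finset.sum_eq_zero fun f _ => (f 0).elim0

lemma kernelSum_succ_succ (h : (Fin (m + 1) → S) → B) (x : Fin (n + 1) → S) :
    kernelSum (m + 1) (n + 1) h x =
      kernelSum (m + 1) n h (Fin.tail x) + kernelSum m n (section₀ h (x 0)) (Fin.tail x) := by
  have comp_cons : ∀ g : Fin m → Fin n,
      x ∘ (Fin.cons 0 (Fin.succ ∘ g) : Fin (m + 1) → Fin (n + 1)) =
        Fin.cons (x 0) (Fin.tail x ∘ g) := fun g =>
    funext fun k => Fin.cases rfl (fun _ => rfl) k
  simp only [kernelSum, section₀, sum_strictMono_fin_succ, comp_cons]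
  rfl

lemma kernelSum_add (h g : (Fin m → S) → B) (x : Fin n → S) :
    kernelSum m n (h + g) x = kernelSum m n h x + kernelSum m n g x :=
  Finset.sum_add_distrib

end KernelSum

section ProductMeasure

variable {S : Type*} [MeasurableSpace S] (ν : Measure S) [IsProbabilityMeasure ν] {m : ℕ}

lemma measurePreserving_comp_of_injective {κ ι : Type*} [Fintype κ] [Fintype ι] {f : κ → ι}
    (hf : Function.Injective f) :
    MeasurePreserving (fun x : ι → S => x ∘ f) (Measure.pi fun _ => ν) (Measure.pi fun _ => ν) := by
  refine ⟨by fun_prop, ?_⟩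
  have indep_coord : iIndepFun (fun (i : ι) (x : ι → S) => x i) (Measure.pi fun _ => ν) :=
    iIndepFun_pi (X := fun _ => id) fun _ => aemeasurable_id
  have map_pi := (iIndepFun_iff_map_fun_eq_pi_map
    fun k => (measurable_pi_apply (f k)).aemeasurable).1
    (indep_coord.precomp hf)
  have map_coord : ∀ i : ι, (Measure.pi fun _ => ν).map (fun x : ι → S => x i) = ν :=
    fun i => (measurePreserving_eval (fun _ : ι => ν) i).map_eq
  simp only [map_coord] at map_pi
  exact map_pi

lemma measurePreserving_finTail :
    MeasurePreserving (Fin.tail : (Fin (m + 1) → S) → Fin m → S)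
      (Measure.pi fun _ => ν) (Measure.pi fun _ => ν) :=
  measurePreserving_comp_of_injective ν (Fin.succ_injective m)

lemma measurePreserving_finCons :
    MeasurePreserving (fun z : S × (Fin m → S) => (Fin.cons z.1 z.2 : Fin (m + 1) → S))
      (ν.prod (Measure.pi fun _ => ν)) (Measure.pi fun _ => ν) := by
  simpa [MeasurableEquiv.piFinSuccAbove, Fin.consEquiv] using
    (measurePreserving_piFinSuccAbove (fun _ : Fin (m + 1) => ν) 0).symm

lemma measurable_finCons :
    Measurable fun z : S × (Fin m → S) => (Fin.cons z.1 z.2 : Fin (m + 1) → S) :=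
  measurable_pi_lambda _ fun k => Fin.cases measurable_fst (fun k => by
    simpa only [Fin.cons_succ] using by fun_prop) k

variable {ν} {F : (Fin (m + 1) → S) → ℝ≥0∞}

lemma lintegral_pi_finSucc (hF : Measurable F) :
    ∫⁻ z, F z ∂(Measure.pi fun _ => ν) =
      ∫⁻ t, ∫⁻ y, F (Fin.cons t y) ∂(Measure.pi fun _ => ν) ∂ν := by
  rw [← (measurePreserving_finCons ν).lintegral_comp hF]
  exact lintegral_prod _ (hF.comp measurable_finCons).aemeasurable

lemma lintegral_pi_finSucc_symm (hF : Measurable F) :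
    ∫⁻ z, F z ∂(Measure.pi fun _ => ν) =
      ∫⁻ y, ∫⁻ t, F (Fin.cons t y) ∂ν ∂(Measure.pi fun _ => ν) := by
  rw [← (measurePreserving_finCons ν).lintegral_comp hF]
  exact lintegral_prod_symm' _ (hF.comp measurable_finCons)

end ProductMeasure

section KernelMoment

variable {S B : Type*} [MeasurableSpace S] {m n : ℕ}

lemma measurable_uncurry_section₀ [MeasurableSpace B] {h : (Fin (m + 1) → S) → B}
    (hh : Measurable h) : Measurable (Function.uncurry (section₀ h)) :=
  hh.comp measurable_finCons

variable [NormedAddCommGroup B] {ν : Measure S} {q : ℝ} {ι : Type*} [Fintype ι]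

/-- The `q`-th absolute moment of a kernel evaluated at independent points of law `ν`. -/
noncomputable def kernelMoment (q : ℝ) (ν : Measure S) (h : (ι → S) → B) : ℝ≥0∞ :=
  ∫⁻ y, ‖h y‖ₑ ^ q ∂(Measure.pi fun _ => ν)

section Measurable

variable [MeasurableSpace B] [BorelSpace B]

lemma kernelMoment_add_le (hq : 1 ≤ q) {h : (ι → S) → B} (hh : Measurable h) (g : (ι → S) → B) :
    kernelMoment q ν (h + g) ≤ 2 ^ (q - 1) * (kernelMoment q ν h + kernelMoment q ν g) := by
  rw [kernelMoment, kernelMoment, kernelMoment, ← lintegral_add_left (hh.enorm.pow_const q),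
    ← lintegral_const_mul' _ _ (by finiteness)]
  exact lintegral_mono fun y => enorm_add_rpow_le hq _ _

lemma kernelMoment_comp_tail [IsProbabilityMeasure ν] {h : (Fin m → S) → B} (hh : Measurable h) :
    kernelMoment q ν (h ∘ Fin.tail) = kernelMoment q ν h :=
  (measurePreserving_finTail ν).lintegral_comp (hh.enorm.pow_const q)

lemma kernelMoment_succ [IsProbabilityMeasure ν] {h : (Fin (m + 1) → S) → B} (hh : Measurable h) :
    kernelMoment q ν h = ∫⁻ t, kernelMoment q ν (section₀ h t) ∂ν :=
  lintegral_pi_finSucc (hh.enorm.pow_const q)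

variable [SecondCountableTopology B]

lemma measurable_kernelSum {h : (Fin m → S) → B} (hh : Measurable h) :
    Measurable (kernelSum m n h) :=
  Finset.measurable_fun_sum _ fun f _ => hh.comp (measurable_pi_lambda _ fun k => by fun_prop)

lemma measurable_uncurry_kernelSum {T : Type*} [MeasurableSpace T] {H : T → (Fin m → S) → B}
    (hH : Measurable (Function.uncurry H)) :
    Measurable (Function.uncurry fun t (x : Fin n → S) => kernelSum m n (H t) x) :=
  Finset.measurable_fun_sum _ fun f _ =>
    hH.comp (measurable_fst.prodMk (measurable_pi_lambda _ fun k => by fun_prop))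

end Measurable

variable [NormedSpace ℝ B]

/-- The mean of a kernel over its first argument, on which the induction on the number of arguments
acts. -/
noncomputable def mean₀ (ν : Measure S) (h : (Fin (m + 1) → S) → B) (y : Fin m → S) : B :=
  ∫ t, section₀ h t y ∂ν

/-- A kernel minus its mean over the first argument, so that its sums over increasing tuples have
centered increments. -/
noncomputable def centered₀ (ν : Measure S) (h : (Fin (m + 1) → S) → B) : (Fin (m + 1) → S) → B :=
  h - mean₀ ν h ∘ Fin.tail

lemma section₀_centered₀ (h : (Fin (m + 1) → S) → B) (t : S) :
    section₀ (centered₀ ν h) t = section₀ h t - mean₀ ν h := by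
  ext y
  simp [centered₀, section₀]

variable [IsProbabilityMeasure ν] {h : (Fin (m + 1) → S) → B}

lemma ae_integrable_kernelSum_section₀_centered₀ [CompleteSpace B]
    (hint : Integrable h (Measure.pi fun _ => ν)) :
    ∀ᵐ x ∂(Measure.pi fun _ : Fin n => ν),
      Integrable (fun t => kernelSum m n (section₀ (centered₀ ν h) t) x) ν ∧
        ∫ t, kernelSum m n (section₀ (centered₀ ν h) t) x ∂ν = 0 := by
  have ae_section : ∀ᵐ y ∂(Measure.pi fun _ => ν), Integrable (fun t => section₀ h t y) ν :=
    ((measurePreserving_finCons ν).integrable_comp_of_integrable hint).prod_left_ae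
  have ae_sample : ∀ᵐ x ∂(Measure.pi fun _ : Fin n => ν), ∀ f : Fin m → Fin n, StrictMono f →
      Integrable (fun t => section₀ h t (x ∘ f)) ν :=
    ae_all_iff.2 fun f => Filter.eventually_imp_distrib_left.2 fun hf =>
      (measurePreserving_comp_of_injective ν hf.injective).quasiMeasurePreserving.ae ae_section
  filter_upwards [ae_sample] with x hx
  simp only [section₀_centered₀]
  have hint_sub : ∀ f : Fin m → Fin n, StrictMono f →
      Integrable (fun t => (section₀ h t - mean₀ ν h) (x ∘ f)) ν :=
    fun f hf => (hx f hf).sub (integrable_const _)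
  refine ⟨integrable_finsetSum _ fun f hf => hint_sub f (by simpa using hf), ?_⟩
  refine (integral_finsetSum _ fun f hf => hint_sub f (by simpa using hf)).trans
    (Finset.sum_eq_zero fun f hf => ?_)
  simp only [Pi.sub_apply]
  rw [integral_sub (hx f (by simpa using hf)) (integrable_const _), integral_const]
  simp [mean₀]

variable [MeasurableSpace B] [BorelSpace B] [SecondCountableTopology B]

lemma kernelMoment_mean₀_le (hq : 1 ≤ q) (hh : Measurable h) :
    kernelMoment q ν (mean₀ ν h) ≤ kernelMoment q ν h := by
  rw [kernelMoment, kernelMoment, lintegral_pi_finSucc_symm (hh.enorm.pow_const q)]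
  exact lintegral_mono fun y => enorm_integral_rpow_le_lintegral
    (measurable_uncurry_section₀ hh).of_uncurry_right.aestronglyMeasurable hq

lemma measurable_mean₀ (hh : Measurable h) : Measurable (mean₀ ν h) :=
  (StronglyMeasurable.integral_prod_left'
    (measurable_uncurry_section₀ hh).stronglyMeasurable).measurable

lemma measurable_centered₀ (hh : Measurable h) : Measurable (centered₀ ν h) :=
  hh.sub ((measurable_mean₀ hh).comp (measurePreserving_finTail ν).measurable)

lemma kernelMoment_centered₀_le (hq : 1 ≤ q) (hh : Measurable h) :
    kernelMoment q ν (centered₀ ν h) ≤ 2 ^ q * kernelMoment q ν h := by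
  rw [kernelMoment, kernelMoment, lintegral_pi_finSucc_symm (hh.enorm.pow_const q),
    lintegral_pi_finSucc_symm ((measurable_centered₀ hh).enorm.pow_const q),
    ← lintegral_const_mul' _ _ (by finiteness)]
  refine lintegral_mono fun y => ?_
  simp only [centered₀, Pi.sub_apply, Function.comp_apply, Fin.tail_cons]
  exact lintegral_enorm_sub_integral_rpow_le
    (measurable_uncurry_section₀ hh).of_uncurry_right.aestronglyMeasurable hq

end KernelMoment

section DegenerateKernel

section Piecewise

variable {S : Type*} [MeasurableSpace S] {κ : Type*} [DecidableEq κ]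

lemma piecewise_eq_piEquivPiSubtypeProd_symm (J : Finset κ) (x y : κ → S) :
    J.piecewise x y = (MeasurableEquiv.piEquivPiSubtypeProd (fun _ : κ => S) (· ∈ J)).symm
      ((MeasurableEquiv.piEquivPiSubtypeProd (fun _ : κ => S) (· ∈ J) x).1,
        (MeasurableEquiv.piEquivPiSubtypeProd (fun _ : κ => S) (· ∈ J) y).2) := by
  ext k
  by_cases hk : k ∈ J <;>
    simp [MeasurableEquiv.piEquivPiSubtypeProd, Equiv.piEquivPiSubtypeProd, hk]

lemma measurePreserving_piecewise [Fintype κ] (ν : Measure S) [IsProbabilityMeasure ν]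
    (J : Finset κ) :
    MeasurePreserving (fun z : (κ → S) × (κ → S) => J.piecewise z.1 z.2)
      ((Measure.pi fun _ => ν).prod (Measure.pi fun _ => ν)) (Measure.pi fun _ => ν) := by
  have split := measurePreserving_piEquivPiSubtypeProd (fun _ : κ => ν) (· ∈ J)
  simp only [piecewise_eq_piEquivPiSubtypeProd_symm]
  exact split.symm.comp ((measurePreserving_fst.comp split).prod (measurePreserving_snd.comp split))

lemma ae_integrable_piecewise [Fintype κ] {B : Type*} [NormedAddCommGroup B] {ν : Measure S}
    [IsProbabilityMeasure ν] {h : (κ → S) → B} (hint : Integrable h (Measure.pi fun _ => ν))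
    (J : Finset κ) :
    ∀ᵐ x ∂(Measure.pi fun _ => ν),
      Integrable (fun y => h (J.piecewise x y)) (Measure.pi fun _ => ν) :=
  ((measurePreserving_piecewise ν J).integrable_comp_of_integrable hint).prod_right_ae

end Piecewise

lemma integral_comp_of_measurePreserving {X Y E : Type*} [MeasurableSpace X] [MeasurableSpace Y]
    [NormedAddCommGroup E] [NormedSpace ℝ E] {ρ : Measure X} {κ : Measure Y} {f : X → Y}
    (hf : MeasurePreserving f ρ κ) {g : Y → E} (hg : AEStronglyMeasurable g κ) :
    ∫ x, g (f x) ∂ρ = ∫ y, g y ∂κ := by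
  rw [← hf.map_eq] at hg ⊢
  exact (integral_map hf.aemeasurable hg).symm

section FinCons

variable {S : Type*} {m : ℕ} (J : Finset (Fin m)) (t : S) (x : Fin m → S)

lemma piecewise_insert_zero_cons (w : Fin (m + 1) → S) :
    (insert 0 (J.map (Fin.succEmb m))).piecewise (Fin.cons t x : Fin (m + 1) → S) w =
      Fin.cons t (J.piecewise x (Fin.tail w)) := by
  ext k
  induction k using Fin.cases with
  | zero => simp
  | succ k => by_cases hk : k ∈ J <;> simp [Finset.piecewise, hk, Fin.tail]

lemma piecewise_map_succ_cons (s : S) (y : Fin m → S) :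
    (J.map (Fin.succEmb m)).piecewise (Fin.cons t x : Fin (m + 1) → S) (Fin.cons s y) =
      Fin.cons s (J.piecewise x y) := by
  ext k
  induction k using Fin.cases with
  | zero => simp [Finset.piecewise]
  | succ k => by_cases hk : k ∈ J <;> simp [Finset.piecewise, hk]

end FinCons

variable {S B : Type*} [MeasurableSpace S] [NormedAddCommGroup B] [NormedSpace ℝ B]
  {ν : Measure S} {m d : ℕ}

/-- An integrable kernel all of whose conditional expectations given fewer than `d` of its
arguments vanish. Given the arguments in `J`, the expectation is written as an integral over the
others. Unlike in `IsDegenerateOfOrder`, the kernel need not be symmetric, and the conditional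
expectations given `d` arguments may vanish as well. -/
structure IsDegenerateKernel (ν : Measure S) (d : ℕ) (h : (Fin m → S) → B) : Prop where
  integrable : Integrable h (Measure.pi fun _ => ν)
  ae_integral_piecewise_eq_zero : ∀ J : Finset (Fin m), J.card < d →
    ∀ᵐ x ∂(Measure.pi fun _ => ν), ∫ y, h (J.piecewise x y) ∂(Measure.pi fun _ => ν) = 0

namespace IsDegenerateKernel

lemma mono {h : (Fin m → S) → B} {e : ℕ} (hd : IsDegenerateKernel ν d h) (hed : e ≤ d) :
    IsDegenerateKernel ν e h :=
  ⟨hd.integrable, fun J hJ => hd.ae_integral_piecewise_eq_zero J (hJ.trans_le hed)⟩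

variable [IsProbabilityMeasure ν]

lemma sub {h g : (Fin m → S) → B} (hh : IsDegenerateKernel ν d h)
    (hg : IsDegenerateKernel ν d g) : IsDegenerateKernel ν d (h - g) := by
  refine ⟨hh.integrable.sub hg.integrable, fun J hJ => ?_⟩
  filter_upwards [hh.ae_integral_piecewise_eq_zero J hJ, hg.ae_integral_piecewise_eq_zero J hJ,
    ae_integrable_piecewise hh.integrable J, ae_integrable_piecewise hg.integrable J]
    with x hh0 hg0 hhi hgi
  simp only [Pi.sub_apply]
  rw [integral_sub hhi hgi, hh0, hg0, sub_zero]

lemma eq_zero [CompleteSpace B] {h : (Fin 0 → S) → B}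
    (hd : IsDegenerateKernel ν (d + 1) h) : h = 0 := by
  obtain ⟨x, hx⟩ := (hd.ae_integral_piecewise_eq_zero ∅ (by simp)).exists
  ext y
  simpa [Subsingleton.elim _ y] using hx

variable {h : (Fin (m + 1) → S) → B}

lemma ae_integrable_section₀ (hd : IsDegenerateKernel ν d h) :
    ∀ᵐ t ∂ν, Integrable (section₀ h t) (Measure.pi fun _ => ν) :=
  ((measurePreserving_finCons ν).integrable_comp_of_integrable hd.integrable).prod_right_ae

lemma ae_section₀ (hd : IsDegenerateKernel ν (d + 1) h) :
    ∀ᵐ t ∂ν, IsDegenerateKernel ν d (section₀ h t) := by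
  have ae_piecewise : ∀ᵐ t ∂ν, ∀ J : Finset (Fin m), J.card < d → ∀ᵐ x ∂(Measure.pi fun _ => ν),
      ∫ w : Fin (m + 1) → S, section₀ h t (J.piecewise x (Fin.tail w))
        ∂(Measure.pi fun _ => ν) = 0 := by
    refine ae_all_iff.2 fun J => Filter.eventually_imp_distrib_left.2 fun hJ => ?_
    have ae_cons := (measurePreserving_finCons ν).quasiMeasurePreserving.ae
      (hd.ae_integral_piecewise_eq_zero (insert 0 (J.map (Fin.succEmb m)))
        ((Finset.card_insert_le _ _).trans_lt (by simpa using hJ)))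
    simp only [piecewise_insert_zero_cons] at ae_cons
    exact Measure.ae_ae_of_ae_prod ae_cons
  filter_upwards [ae_piecewise, hd.ae_integrable_section₀] with t ht hint
  refine ⟨hint, fun J hJ => ?_⟩
  filter_upwards [ht J hJ, ae_integrable_piecewise hint J] with x hx hxint
  rwa [← integral_comp_of_measurePreserving (measurePreserving_finTail ν)
    hxint.aestronglyMeasurable]

lemma mean₀ (hd : IsDegenerateKernel ν d h) : IsDegenerateKernel ν d (mean₀ ν h) := by
  refine ⟨((measurePreserving_finCons ν).integrable_comp_of_integrable
    hd.integrable).integral_prod_right, fun J hJ => ?_⟩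
  set J' := J.map (Fin.succEmb m)
  obtain ⟨t, ht⟩ := (Measure.ae_ae_of_ae_prod
    ((measurePreserving_finCons ν).quasiMeasurePreserving.ae
      ((hd.ae_integral_piecewise_eq_zero J' (by simpa [J'] using hJ)).and
        (ae_integrable_piecewise hd.integrable J')))).exists
  filter_upwards [ht] with x ⟨hx, hxint⟩
  have hcons := measurePreserving_finCons (m := m) ν
  calc ∫ y, IncompleteUStat.mean₀ ν h (J.piecewise x y) ∂(Measure.pi fun _ => ν)
      = ∫ y, ∫ s, h (J'.piecewise (Fin.cons t x) (Fin.cons s y)) ∂ν ∂(Measure.pi fun _ => ν) := by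
        simp only [J', piecewise_map_succ_cons]
        rfl
    _ = ∫ z, h (J'.piecewise (Fin.cons t x) (Fin.cons z.1 z.2))
          ∂(ν.prod (Measure.pi fun _ => ν)) :=
        (integral_prod_symm _ (hcons.integrable_comp_of_integrable hxint)).symm
    _ = ∫ w, h (J'.piecewise (Fin.cons t x) w) ∂(Measure.pi fun _ => ν) :=
        integral_comp_of_measurePreserving hcons hxint.aestronglyMeasurable
    _ = 0 := hx

lemma ae_section₀_centered₀ (hd : IsDegenerateKernel ν (d + 1) h) :
    ∀ᵐ t ∂ν, IsDegenerateKernel ν d (section₀ (centered₀ ν h) t) := by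
  filter_upwards [hd.ae_section₀] with t ht
  rw [section₀_centered₀]
  exact ht.sub (hd.mean₀.mono d.le_succ)

end IsDegenerateKernel

end DegenerateKernel

section KernelSumMoment

variable {S B : Type*} [MeasurableSpace S] [NormedAddCommGroup B] {ν : Measure S}
  {p q : ℝ} {m n : ℕ}

lemma kernelMoment_kernelSum_succ_zero (hq : 0 < q) (h : (Fin (m + 1) → S) → B) :
    kernelMoment q ν (kernelSum (m + 1) 0 h) = 0 := by
  simp [kernelMoment, kernelSum_succ_zero, ENNReal.zero_rpow_of_pos hq]

variable [IsProbabilityMeasure ν]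

lemma kernelMoment_kernelSum_zero_left (h : (Fin 0 → S) → B) :
    kernelMoment q ν (kernelSum 0 n h) = kernelMoment q ν h := by
  have h_eq : ∀ y, h y = h default := fun y => congrArg h (Subsingleton.elim y default)
  simp [kernelMoment, kernelSum_zero_left, h_eq]

variable [MeasurableSpace B] [BorelSpace B]

lemma lintegral_kernelMoment_kernelSum_section₀_le {h : (Fin (m + 1) → S) → B} (hh : Measurable h)
    {K : ℝ≥0∞} (hK : ∀ᵐ t ∂ν, kernelMoment q ν (kernelSum m n (section₀ h t)) ≤
      K * kernelMoment q ν (section₀ h t)) :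
    ∫⁻ t, kernelMoment q ν (kernelSum m n (section₀ h t)) ∂ν ≤ K * kernelMoment q ν h := by
  have hmeas : Measurable fun t => kernelMoment q ν (section₀ h t) :=
    ((measurable_uncurry_section₀ hh).enorm.pow_const q).lintegral_prod_right'
  rw [kernelMoment_succ hh, ← lintegral_const_mul _ hmeas]
  exact lintegral_mono_ae hK

variable [SecondCountableTopology B]

/- Minkowski's inequality, for the decomposition of the sum by the first index. -/
lemma rpow_inv_kernelMoment_kernelSum_succ_succ_le (hq : 1 ≤ q) {h : (Fin (m + 1) → S) → B}
    (hh : Measurable h) :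
    kernelMoment q ν (kernelSum (m + 1) (n + 1) h) ^ q⁻¹ ≤
      kernelMoment q ν (kernelSum (m + 1) n h) ^ q⁻¹ +
        (∫⁻ t, kernelMoment q ν (kernelSum m n (section₀ h t)) ∂ν) ^ q⁻¹ := by
  have htail := measurePreserving_finTail (m := n) ν
  have hlast : Measurable fun z : Fin (n + 1) → S =>
      ‖kernelSum m n (section₀ h (z 0)) (Fin.tail z)‖ₑ :=
    ((measurable_uncurry_kernelSum (measurable_uncurry_section₀ hh)).comp
      ((measurable_pi_apply 0).prodMk htail.measurable)).enorm
  have hprev : Measurable fun z : Fin (n + 1) → S => ‖kernelSum (m + 1) n h (Fin.tail z)‖ₑ :=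
    ((measurable_kernelSum hh).comp htail.measurable).enorm
  have lintegral_last : ∫⁻ t, kernelMoment q ν (kernelSum m n (section₀ h t)) ∂ν =
      ∫⁻ z, ‖kernelSum m n (section₀ h (z 0)) (Fin.tail z)‖ₑ ^ q ∂(Measure.pi fun _ => ν) :=
    (lintegral_pi_finSucc (hlast.pow_const q)).symm
  rw [lintegral_last, ← kernelMoment_comp_tail (measurable_kernelSum (n := n) hh)]
  simp only [← one_div]
  refine le_trans ?_ (ENNReal.lintegral_Lp_add_le hprev.aemeasurable hlast.aemeasurable hq)
  unfold kernelMoment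
  gcongr with z
  rw [kernelSum_succ_succ]
  exact enorm_add_le _ _

lemma kernelMoment_kernelSum_succ_le (hq : 1 ≤ q) {h : (Fin (m + 1) → S) → B}
    (hh : Measurable h) {A : ℝ≥0∞}
    (hA : ∀ k < n, ∫⁻ t, kernelMoment q ν (kernelSum m k (section₀ h t)) ∂ν ≤ A) :
    kernelMoment q ν (kernelSum (m + 1) n h) ≤ n ^ q * A := by
  have hq0 : 0 < q := by linarith
  have root_le : ∀ k ≤ n, kernelMoment q ν (kernelSum (m + 1) k h) ^ q⁻¹ ≤ k * A ^ q⁻¹ := by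
    intro k
    induction k with
    | zero => simp [kernelMoment_kernelSum_succ_zero hq0, hq0]
    | succ k ih =>
      intro hk
      calc kernelMoment q ν (kernelSum (m + 1) (k + 1) h) ^ q⁻¹
          ≤ _ := rpow_inv_kernelMoment_kernelSum_succ_succ_le hq hh
        _ ≤ k * A ^ q⁻¹ + A ^ q⁻¹ := by
            gcongr
            · exact ih (by lia)
            · exact hA k (by lia)
        _ = (k + 1 : ℕ) * A ^ q⁻¹ := by push_cast; ring
  calc kernelMoment q ν (kernelSum (m + 1) n h) ≤ (n * A ^ q⁻¹) ^ q :=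
        (ENNReal.rpow_inv_le_iff hq0).1 (root_le n le_rfl)
    _ = n ^ q * A := by
        rw [ENNReal.mul_rpow_of_nonneg _ _ hq0.le, ENNReal.rpow_inv_rpow hq0.ne']

variable [NormedSpace ℝ B] [CompleteSpace B] {Φ : B → ℝ≥0∞} {c : ℝ≥0∞}

lemma IsPotential.lintegral_kernelSum_succ_succ_centered₀_le (hΦ : IsPotential p q Φ c)
    (hp : 0 < p) (hpq : p ≤ q) {h : (Fin (m + 1) → S) → B} (hh : Measurable h)
    (hint : Integrable h (Measure.pi fun _ => ν)) {A : ℝ≥0∞}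
    (hA : ∫⁻ t, kernelMoment q ν (kernelSum m n (section₀ (centered₀ ν h) t)) ∂ν ≤ A) :
    ∫⁻ z, Φ (kernelSum (m + 1) (n + 1) (centered₀ ν h) z) ∂(Measure.pi fun _ => ν) ≤
      ∫⁻ x, Φ (kernelSum (m + 1) n (centered₀ ν h) x) ∂(Measure.pi fun _ => ν) + c ^ 2 *
        ((∫⁻ x, Φ (kernelSum (m + 1) n (centered₀ ν h) x) ∂(Measure.pi fun _ => ν)) ^ (1 - p / q) *
          A ^ (p / q) + A) := by
  have hq : 0 < q := hp.trans_le hpq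
  have hg := measurable_centered₀ (ν := ν) hh
  set g := centered₀ ν h
  have hD : Measurable (Function.uncurry fun (x : Fin n → S) t => kernelSum m n (section₀ g t) x) :=
    (measurable_uncurry_kernelSum (measurable_uncurry_section₀ hg)).comp measurable_swap
  have lintegral_rpow_le : ∫⁻ x, ∫⁻ t, ‖kernelSum m n (section₀ g t) x‖ₑ ^ q ∂ν
      ∂(Measure.pi fun _ => ν) ≤ A := by
    rw [lintegral_lintegral_swap (hD.enorm.pow_const q).aemeasurable]
    exact hA
  rw [lintegral_pi_finSucc_symm (F := fun z => Φ (kernelSum (m + 1) (n + 1) g z))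
    (hΦ.measurable.comp (measurable_kernelSum hg))]
  simp only [kernelSum_succ_succ, Fin.cons_zero, Fin.tail_cons]
  refine hΦ.lintegral_add_centered_le hp hpq (measurable_kernelSum hg).aemeasurable hD.aemeasurable
    (ae_integrable_kernelSum_section₀_centered₀ hint) ?_ lintegral_rpow_le
  rw [← ENNReal.rpow_mul, div_mul_div_cancel₀ hq.ne', div_self hp.ne', ENNReal.rpow_one]
  refine (lintegral_mono fun x => ?_).trans lintegral_rpow_le
  refine (rpow_lintegral_le_lintegral_rpow
    (hD.of_uncurry_left.enorm.pow_const p).aemeasurable ((one_le_div hp).2 hpq)).trans_eq ?_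
  simp only [← ENNReal.rpow_mul, mul_div_cancel₀ q hp.ne']

lemma IsPotential.kernelMoment_kernelSum_succ_centered₀_le (hΦ : IsPotential p q Φ c)
    (hp : 0 < p) (hpq : p ≤ q) {h : (Fin (m + 1) → S) → B} (hh : Measurable h)
    (hint : Integrable h (Measure.pi fun _ => ν)) {A : ℝ≥0∞}
    (hA : ∀ k < n, ∫⁻ t, kernelMoment q ν (kernelSum m k (section₀ (centered₀ ν h) t)) ∂ν ≤ A) :
    kernelMoment q ν (kernelSum (m + 1) n (centered₀ ν h)) ≤
      rosenthalConst p q c * (2 * (n ^ (q / p) * A)) := by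
  have hq : 0 < q := hp.trans_le hpq
  have hs : 1 ≤ q / p := (one_le_div hp).2 hpq
  have recursion := nat_recursion_le hs (one_le_pow₀ hΦ.one_le) (n := n) (v := A ^ (p / q))
    (u := fun k => ∫⁻ x, Φ (kernelSum (m + 1) k (centered₀ ν h) x) ∂(Measure.pi fun _ => ν))
    (by simp [kernelSum_succ_zero, hΦ.map_zero hq]) fun k hk => by
      rw [inv_div]
      exact hΦ.lintegral_kernelSum_succ_succ_centered₀_le hp hpq hh hint (hA k hk)
  have n_le : (n : ℝ≥0∞) ≤ n ^ (q / p) := by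
    rcases n.eq_zero_or_pos with rfl | hn
    · simp
    · exact ENNReal.le_rpow_self_of_one_le (Nat.one_le_cast.2 hn) hs
  calc kernelMoment q ν (kernelSum (m + 1) n (centered₀ ν h))
      ≤ c * ((2 * c ^ 2) ^ (q / p) * ((n * A ^ (p / q)) ^ (q / p) + n * A)) :=
        (hΦ.lintegral_enorm_rpow_le _).trans (by gcongr)
    _ ≤ c * ((2 * c ^ 2) ^ (q / p) * (n ^ (q / p) * A + n ^ (q / p) * A)) := by
        rw [ENNReal.mul_rpow_of_nonneg _ (A ^ (p / q)) (by linarith), ← ENNReal.rpow_mul,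
          div_mul_div_cancel₀ hq.ne', div_self hp.ne', ENNReal.rpow_one]
        gcongr
    _ = rosenthalConst p q c * (2 * (n ^ (q / p) * A)) := by rw [rosenthalConst]; ring

/-- The power of the sample size in the bound for the `q`-th moment of a sum over increasing
`m`-tuples of a degenerate kernel of order `d`. -/
noncomputable def kernelExponent (p q : ℝ) (m d : ℕ) : ℝ := q * (m - d) + d * q / p

lemma kernelExponent_succ_left (d : ℕ) :
    kernelExponent p q (m + 1) d = q + kernelExponent p q m d := by
  simp only [kernelExponent]
  push_cast
  ring

lemma kernelExponent_succ_succ (d : ℕ) :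
    kernelExponent p q (m + 1) (d + 1) = q / p + kernelExponent p q m d := by
  simp only [kernelExponent]
  push_cast
  ring

/-- The factor by which the constant in the moment bound for sums over increasing `m`-tuples grows
when `m` increases by one. -/
noncomputable def kernelSumConst (p q : ℝ) (c : ℝ≥0∞) : ℝ≥0∞ :=
  2 ^ (q - 1) * (rosenthalConst p q c * (2 * 2 ^ q) + 1)

lemma one_le_kernelSumConst (hq : 1 ≤ q) : 1 ≤ kernelSumConst p q c :=
  one_le_mul (by simpa using ENNReal.rpow_le_rpow_of_exponent_le one_le_two (sub_nonneg.2 hq))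
    le_add_self

lemma kernelSumConst_ne_top (hp : 0 ≤ p) (hq : 1 ≤ q) (hc : c ≠ ∞) : kernelSumConst p q c ≠ ∞ := by
  have := rosenthalConst_ne_top hp (by linarith : 0 ≤ q) hc
  unfold kernelSumConst
  finiteness

/- The kernel is split into its mean over the first argument, to which the triangle inequality
applies, and the remainder, whose sums are a martingale in the sample size. -/
lemma IsPotential.kernelMoment_kernelSum_succ_le (hΦ : IsPotential p q Φ c) (hp : 0 < p)
    (hpq : p ≤ q) (hq : 1 ≤ q) {h : (Fin (m + 1) → S) → B} (hh : Measurable h)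
    (hint : Integrable h (Measure.pi fun _ => ν)) {K₁ K₂ : ℝ≥0∞}
    (hsection : ∀ k < n, ∀ᵐ t ∂ν, kernelMoment q ν (kernelSum m k (section₀ (centered₀ ν h) t)) ≤
      K₁ * kernelMoment q ν (section₀ (centered₀ ν h) t))
    (hmean : ∀ k < n, kernelMoment q ν (kernelSum m k (mean₀ ν h)) ≤
      K₂ * kernelMoment q ν (mean₀ ν h)) :
    kernelMoment q ν (kernelSum (m + 1) n h) ≤ 2 ^ (q - 1) *
      (rosenthalConst p q c * (2 * 2 ^ q) * (n ^ (q / p) * K₁) + n ^ q * K₂) *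
        kernelMoment q ν h := by
  have hcentered := measurable_centered₀ (ν := ν) hh
  have hmean_tail := (measurable_mean₀ (ν := ν) hh).comp (measurePreserving_finTail ν).measurable
  have section₀_mean_tail : ∀ t, section₀ (mean₀ ν h ∘ Fin.tail) t = mean₀ ν h := fun t => by
    ext y
    simp [section₀]
  have centered_le : kernelMoment q ν (kernelSum (m + 1) n (centered₀ ν h)) ≤
      rosenthalConst p q c * (2 * (n ^ (q / p) * (K₁ * (2 ^ q * kernelMoment q ν h)))) :=
    hΦ.kernelMoment_kernelSum_succ_centered₀_le hp hpq hh hint fun k hk =>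
      (lintegral_kernelMoment_kernelSum_section₀_le hcentered (hsection k hk)).trans
        (mul_le_mul_right (kernelMoment_centered₀_le hq hh) _)
  have mean_le : kernelMoment q ν (kernelSum (m + 1) n (mean₀ ν h ∘ Fin.tail)) ≤
      n ^ q * (K₂ * kernelMoment q ν h) :=
    IncompleteUStat.kernelMoment_kernelSum_succ_le hq hmean_tail fun k hk => by
      simpa [section₀_mean_tail] using
        (hmean k hk).trans (mul_le_mul_right (kernelMoment_mean₀_le hq hh) _)
  have split : kernelSum (m + 1) n h =
      kernelSum (m + 1) n (centered₀ ν h) + kernelSum (m + 1) n (mean₀ ν h ∘ Fin.tail) := by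
    ext x
    rw [Pi.add_apply, ← kernelSum_add, centered₀, sub_add_cancel]
  calc kernelMoment q ν (kernelSum (m + 1) n h)
      ≤ 2 ^ (q - 1) * (rosenthalConst p q c *
          (2 * (n ^ (q / p) * (K₁ * (2 ^ q * kernelMoment q ν h)))) +
            n ^ q * (K₂ * kernelMoment q ν h)) := by
        rw [split]
        exact (kernelMoment_add_le hq (measurable_kernelSum hcentered) _).trans (by gcongr)
    _ = _ := by ring

lemma IsPotential.kernelMoment_kernelSum_le (hΦ : IsPotential p q Φ c) (hp : 0 < p) (hpq : p ≤ q)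
    (hq : 1 ≤ q) {d : ℕ} {h : (Fin m → S) → B} (hh : Measurable h)
    (hd : IsDegenerateKernel ν d h) {N : ℕ} (hN : N ≠ 0) (hnN : n ≤ N) :
    kernelMoment q ν (kernelSum m n h) ≤
      kernelSumConst p q c ^ m * N ^ kernelExponent p q m d * kernelMoment q ν h := by
  have rpow_mul_rpow : ∀ a b : ℝ, (N : ℝ≥0∞) ^ a * N ^ b = N ^ (a + b) := fun a b =>
    (ENNReal.rpow_add a b (by simpa) (by simp)).symm
  set K := kernelSumConst p q c with K_def
  have one_le : 1 ≤ K := one_le_kernelSumConst hq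
  induction m generalizing n d with
  | zero =>
    rw [kernelMoment_kernelSum_zero_left]
    cases d with
    | zero => simp [kernelExponent]
    | succ d => simp [hd.eq_zero, kernelMoment, ENNReal.zero_rpow_of_pos (hp.trans_le hpq)]
  | succ m ih =>
    cases d with
    | zero =>
      calc kernelMoment q ν (kernelSum (m + 1) n h)
          ≤ n ^ q * (K ^ m * N ^ kernelExponent p q m 0 * kernelMoment q ν h) :=
            IncompleteUStat.kernelMoment_kernelSum_succ_le hq hh fun k hk =>
              lintegral_kernelMoment_kernelSum_section₀_le hh <| by
                filter_upwards [hd.ae_integrable_section₀] with t ht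
                exact ih (measurable_uncurry_section₀ hh).of_uncurry_left ⟨ht, by simp⟩
                  (hk.le.trans hnN)
        _ ≤ N ^ q * (K ^ (m + 1) * N ^ kernelExponent p q m 0 * kernelMoment q ν h) := by
            gcongr
            exact m.le_succ
        _ = K ^ (m + 1) * N ^ kernelExponent p q (m + 1) 0 * kernelMoment q ν h := by
            rw [kernelExponent_succ_left, ← rpow_mul_rpow]
            ring
    | succ d =>
      calc kernelMoment q ν (kernelSum (m + 1) n h)
          ≤ 2 ^ (q - 1) * (rosenthalConst p q c * (2 * 2 ^ q) *
              (n ^ (q / p) * (K ^ m * N ^ kernelExponent p q m d)) +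
                n ^ q * (K ^ m * N ^ kernelExponent p q m (d + 1))) * kernelMoment q ν h := by
            refine hΦ.kernelMoment_kernelSum_succ_le hp hpq hq hh hd.integrable (fun k hk => ?_)
              fun k hk => ih (measurable_mean₀ hh) hd.mean₀ (hk.le.trans hnN)
            filter_upwards [hd.ae_section₀_centered₀] with t ht
            exact ih (measurable_uncurry_section₀ (measurable_centered₀ hh)).of_uncurry_left ht
              (hk.le.trans hnN)
        _ ≤ 2 ^ (q - 1) * (rosenthalConst p q c * (2 * 2 ^ q) *
              (N ^ (q / p) * (K ^ m * N ^ kernelExponent p q m d)) +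
                N ^ q * (K ^ m * N ^ kernelExponent p q m (d + 1))) * kernelMoment q ν h := by
            gcongr
        _ = 2 ^ (q - 1) * (rosenthalConst p q c * (2 * 2 ^ q) *
              (K ^ m * N ^ kernelExponent p q (m + 1) (d + 1)) +
                K ^ m * N ^ kernelExponent p q (m + 1) (d + 1)) * kernelMoment q ν h := by
            nth_rw 2 [kernelExponent_succ_left]
            rw [kernelExponent_succ_succ, ← rpow_mul_rpow, ← rpow_mul_rpow]
            ring
        _ = K ^ (m + 1) * N ^ kernelExponent p q (m + 1) (d + 1) * kernelMoment q ν h := by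
            rw [pow_succ, K_def, kernelSumConst]
            ring

end KernelSumMoment

section CondExp

variable {Ω X Y E : Type*} {m₀ : MeasurableSpace Ω} [mΩ : MeasurableSpace Ω] [MeasurableSpace X]
  [MeasurableSpace Y] [NormedAddCommGroup E] [NormedSpace ℝ E] {μ : Measure Ω} {ρ : Measure X}
  {κ : Measure Y} [SFinite κ] {φ : Ω → X × Y} {f : X × Y → E}

lemma setIntegral_integral_prod_eq_setIntegral_comp [SFinite ρ]
    (hφ : MeasurePreserving φ μ (ρ.prod κ)) (hf : Integrable f (ρ.prod κ)) {A : Set X}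
    (hA : MeasurableSet A) :
    ∫ x in A, ∫ y, f (x, y) ∂κ ∂ρ = ∫ ω in (fun ω => (φ ω).1) ⁻¹' A, f (φ ω) ∂μ := by
  calc ∫ x in A, ∫ y, f (x, y) ∂κ ∂ρ = ∫ z in A ×ˢ Set.univ, f z ∂(ρ.prod κ) := by
        rw [setIntegral_prod f hf.integrableOn]
        simp only [Measure.restrict_univ]
    _ = ∫ ω in φ ⁻¹' (A ×ˢ Set.univ), f (φ ω) ∂μ := by
        rw [← hφ.map_eq, setIntegral_map (hA.prod MeasurableSet.univ)
          (hφ.map_eq ▸ hf.aestronglyMeasurable) hφ.aemeasurable]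
    _ = ∫ ω in (fun ω => (φ ω).1) ⁻¹' A, f (φ ω) ∂μ := by
        rw [Set.prod_univ]
        rfl

lemma ae_integral_eq_zero_of_condExp_eq_zero [SigmaFinite ρ] [CompleteSpace E] [IsFiniteMeasure μ]
    (hφ : MeasurePreserving φ μ (ρ.prod κ)) (hf : Integrable f (ρ.prod κ))
    (hm₀ : m₀ ≤ mΩ) (hfst : Measurable[m₀] fun ω => (φ ω).1)
    (hcond : μ[fun ω => f (φ ω) | m₀] =ᵐ[μ] 0) :
    ∀ᵐ x ∂ρ, ∫ y, f (x, y) ∂κ = 0 := by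
  refine hf.integral_prod_left.ae_eq_zero_of_forall_setIntegral_eq_zero fun A hA _ => ?_
  calc ∫ x in A, ∫ y, f (x, y) ∂κ ∂ρ = ∫ ω in (fun ω => (φ ω).1) ⁻¹' A, f (φ ω) ∂μ :=
        setIntegral_integral_prod_eq_setIntegral_comp hφ hf hA
    _ = ∫ ω in (fun ω => (φ ω).1) ⁻¹' A, μ[fun ω => f (φ ω) | m₀] ω ∂μ :=
        (setIntegral_condExp hm₀ (hφ.integrable_comp_of_integrable hf) (hfst hA)).symm
    _ = 0 := by
        rw [setIntegral_congr_ae (g := fun _ => 0) (hm₀ _ (hfst hA))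
          (hcond.mono fun ω hω _ => hω), integral_zero]

end CondExp

lemma exists_perm_forall_mem_lt_card {m : ℕ} (J : Finset (Fin m)) :
    ∃ σ : Equiv.Perm (Fin m), ∀ k ∈ J, (σ k : ℕ) < J.card := by
  obtain ⟨J', hJ', hcard⟩ := Finset.exists_subset_card_eq
    (s := Finset.univ.map (Fin.castLEEmb (card_finset_fin_le J))) (n := J.card) (by simp)
  refine ⟨(Finset.equivOfCardEq hcard.symm).extendSubtype, fun k hk => ?_⟩
  obtain ⟨i, -, hi⟩ := Finset.mem_map.1
    (hJ' (Equiv.extendSubtype_mem (Finset.equivOfCardEq hcard.symm) k hk))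
  rw [← hi]
  exact i.2

section IID

variable {Ω S : Type*} [MeasurableSpace Ω] [MeasurableSpace S] {μ : Measure Ω} {ξ : ℤ → Ω → S}

namespace IsIID

lemma measurable_firstVec (hξ : IsIID μ ξ) (k : ℕ) : Measurable (firstVec ξ k) :=
  measurable_pi_lambda _ fun _ => hξ.1 _

variable [IsProbabilityMeasure μ]

lemma isProbabilityMeasure_map (hξ : IsIID μ ξ) (i : ℤ) : IsProbabilityMeasure (μ.map (ξ i)) :=
  Measure.isProbabilityMeasure_map (hξ.1 i).aemeasurable

lemma measurePreserving_pi (hξ : IsIID μ ξ) {κ : Type*} [Fintype κ] {g : κ → ℤ}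
    (hg : Function.Injective g) :
    MeasurePreserving (fun ω k => ξ (g k) ω) μ (Measure.pi fun _ => μ.map (ξ 1)) := by
  refine ⟨measurable_pi_lambda _ fun k => hξ.1 _, ?_⟩
  rw [(iIndepFun_iff_map_fun_eq_pi_map fun k => (hξ.1 (g k)).aemeasurable).1 (hξ.2.1.precomp hg)]
  congr 1
  ext1 k
  exact (hξ.2.2 (g k) 1).map_eq

lemma measurePreserving_firstVec (hξ : IsIID μ ξ) (k : ℕ) :
    MeasurePreserving (firstVec ξ k) μ (Measure.pi fun _ => μ.map (ξ 1)) :=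
  hξ.measurePreserving_pi fun _ _ hij => Fin.ext (by simpa using hij)

variable {B : Type*} [NormedAddCommGroup B] [NormedSpace ℝ B] [CompleteSpace B]
  [MeasurableSpace B] [BorelSpace B] [SecondCountableTopology B] {m d : ℕ} {h : (Fin m → S) → B}

/- Symmetry allows the arguments in `J` to be moved to the first `#J` places. -/
lemma isDegenerateKernel (hξ : IsIID μ ξ) (hh : Measurable h) (hsymm : IsSymmKernel h)
    (hdeg : IsDegenerateOfOrder μ ξ h d) : IsDegenerateKernel (μ.map (ξ 1)) d h := by
  have := hξ.isProbabilityMeasure_map 1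
  set ν := μ.map (ξ 1)
  obtain ⟨hint, hcond, -⟩ := hdeg
  have hint_pi : Integrable h (Measure.pi fun _ => ν) :=
    ((hξ.measurePreserving_firstVec m).integrable_comp hh.aestronglyMeasurable).1 hint
  refine ⟨hint_pi, fun J hJ => ?_⟩
  obtain ⟨σ, hσ⟩ := exists_perm_forall_mem_lt_card J
  set E := MeasurableEquiv.piEquivPiSubtypeProd (fun _ : Fin m => S) (· ∈ J)
  have hE := measurePreserving_piEquivPiSubtypeProd (fun _ : Fin m => ν) (· ∈ J)
  have permuted_preserving : MeasurePreserving (fun ω k => firstVec ξ m ω (σ k)) μ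
      (Measure.pi fun _ => ν) :=
    hξ.measurePreserving_pi (g := fun k => ((σ k : ℕ) : ℤ) + 1)
      fun k l hkl => σ.injective (Fin.ext (by simpa using hkl))
  have fst_measurable : Measurable[firstSigma ξ (d - 1)]
      fun ω => (E fun k => firstVec ξ m ω (σ k)).1 :=
    (measurable_pi_lambda (fun (v : Fin (d - 1) → S) (j : {k // k ∈ J}) =>
      v ⟨σ j, (hσ j j.2).trans_le (Nat.le_sub_one_of_lt hJ)⟩) fun _ => measurable_pi_apply _).comp
      (comap_measurable (firstVec ξ (d - 1)))
  have ae_zero := ae_integral_eq_zero_of_condExp_eq_zero (f := fun z => h (E.symm z))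
    (hE.comp permuted_preserving) (hE.symm.integrable_comp_of_integrable hint_pi)
    (hξ.measurable_firstVec (d - 1)).comap_le fst_measurable
    (by simpa [E, hsymm σ (firstVec ξ m _)] using hcond)
  filter_upwards [(measurePreserving_fst.comp hE).quasiMeasurePreserving.ae ae_zero] with x hx
  simp only [piecewise_eq_piEquivPiSubtypeProd_symm]
  exact (integral_comp_of_measurePreserving (measurePreserving_snd.comp hE)
    (hh.comp (E.symm.measurable.comp measurable_prodMk_left)).aestronglyMeasurable).trans hx

end IsIID

end IID

section Inc

variable {m n : ℕ}

lemma card_Inc_le (m n : ℕ) : (Inc m n).card ≤ n ^ m :=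
  (Finset.card_filter_le _ _).trans (by simp)

lemma isEmpty_Inc_zero (hm : m ≠ 0) : IsEmpty (Inc m 0) :=
  Finset.isEmpty_coe_sort.2 <| Finset.card_eq_zero.1 <| by simpa [hm] using card_Inc_le m 0

lemma mem_Icc_of_mem_Inc {i : Fin m → ℤ} (hi : i ∈ Inc m n) (k : Fin m) :
    i k ∈ Finset.Icc (1 : ℤ) n :=
  Fintype.mem_piFinset.1 (Finset.mem_filter.1 hi).1 k

lemma strictMono_of_mem_Inc {i : Fin m → ℤ} (hi : i ∈ Inc m n) : StrictMono i :=
  fun j k hjk => (Finset.mem_filter.1 hi).2 j k hjk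

lemma natCast_add_one_mem_Inc {f : Fin m → Fin n} (hf : StrictMono f) :
    (fun k => ((f k : ℕ) : ℤ) + 1) ∈ Inc m n := by
  refine Finset.mem_filter.2 ⟨Fintype.mem_piFinset.2 fun k => Finset.mem_Icc.2 ?_,
    fun j k hjk => by simpa using hf hjk⟩
  have := (f k).is_lt
  lia

lemma exists_strictMono_of_mem_Inc {i : Fin m → ℤ} (hi : i ∈ Inc m n) :
    ∃ f : Fin m → Fin n, StrictMono f ∧ (fun k => ((f k : ℕ) : ℤ) + 1) = i := by
  have bounds : ∀ k, 1 ≤ i k ∧ i k ≤ n := fun k => Finset.mem_Icc.1 (mem_Icc_of_mem_Inc hi k)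
  refine ⟨fun k => ⟨(i k - 1).toNat, by have := bounds k; lia⟩, fun j k hjk => ?_, ?_⟩
  · have := strictMono_of_mem_Inc hi hjk
    have := bounds j
    rw [Fin.lt_def]
    lia
  · ext k
    have := bounds k
    lia

lemma sum_Inc_eq_kernelSum {Ω S B : Type*} [AddCommMonoid B] (m n : ℕ) (ξ : ℤ → Ω → S)
    (h : (Fin m → S) → B) (ω : Ω) :
    ∑ i : Inc m n, h (fun k => ξ (i.1 k) ω) = kernelSum m n h (firstVec ξ n ω) := by
  classical
  rw [Finset.sum_coe_sort (Inc m n) fun i => h fun k => ξ (i k) ω, kernelSum]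
  symm
  refine Finset.sum_bij (fun f _ k => ((f k : ℕ) : ℤ) + 1)
    (fun f hf => natCast_add_one_mem_Inc (Finset.mem_filter.1 hf).2)
    (fun f _ g _ hfg => funext fun k => Fin.ext (by simpa using congrFun hfg k))
    (fun i hi => ?_) fun f _ => rfl
  obtain ⟨f, hf, hfi⟩ := exists_strictMono_of_mem_Inc hi
  exact ⟨f, Finset.mem_filter.2 ⟨Finset.mem_univ f, hf⟩, hfi⟩

lemma incompleteUStat_eq_smul_kernelSum_add {Ω S B : Type*} [NormedAddCommGroup B]
    [NormedSpace ℝ B] (a : Inc m n → Ω → ℝ) (ξ : ℤ → Ω → S) (h : (Fin m → S) → B) (r : ℝ) (ω : Ω) :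
    incompleteUStat a ξ h ω = r • kernelSum m n h (firstVec ξ n ω) +
      incompleteUStat (fun i ω => a i ω - r) ξ h ω := by
  rw [← sum_Inc_eq_kernelSum, incompleteUStat, incompleteUStat, Finset.smul_sum,
    ← Finset.sum_add_distrib]
  simp only [← add_smul, add_sub_cancel]

end Inc

section Bernoulli

lemma lintegral_bernoulliMeasure {X : Type*} [MeasurableSpace X] [MeasurableSingletonClass X]
    (x y : X) (r : unitInterval) (f : X → ℝ≥0∞) :
    ∫⁻ z, f z ∂(bernoulliMeasure x y r) =
      ENNReal.ofReal r * f x + ENNReal.ofReal (1 - r) * f y := by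
  have coe_toNNReal : ∀ s : unitInterval, (unitInterval.toNNReal s : ℝ≥0∞) = ENNReal.ofReal s :=
    fun s => (ENNReal.ofReal_eq_coe_nnreal s.2.1).symm
  simp [bernoulliMeasure_def, lintegral_add_measure, ENNReal.smul_def, coe_toNNReal]

variable {Ω : Type*} [MeasurableSpace Ω] {μ : Measure Ω} {r : unitInterval} {a : Ω → ℝ}

lemma integrable_of_hasLaw_bernoulliMeasure {x y : ℝ} (ha : HasLaw a (bernoulliMeasure x y r) μ) :
    Integrable a μ := by
  have := integrable_bernoulliMeasure x y r id
  rw [← ha.map_eq] at this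
  exact this.comp_aemeasurable ha.aemeasurable

lemma integral_of_hasLaw_bernoulliMeasure (ha : HasLaw a (bernoulliMeasure (1 : ℝ) 0 r) μ) :
    ∫ ω, a ω ∂μ = r := by
  rw [ha.integral_eq]
  simpa using integral_bernoulliMeasure (1 : ℝ) 0 r id

lemma lintegral_enorm_sub_rpow_le_of_hasLaw_bernoulliMeasure
    (ha : HasLaw a (bernoulliMeasure (1 : ℝ) 0 r) μ) {t : ℝ} (ht : 1 ≤ t) :
    ∫⁻ ω, ‖a ω - r‖ₑ ^ t ∂μ ≤ 2 * ENNReal.ofReal r := by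
  have r_nonneg : (0 : ℝ) ≤ r := r.2.1
  have r_le : (r : ℝ) ≤ 1 := r.2.2
  have enorm_one_sub : ‖(1 : ℝ) - r‖ₑ ≤ 1 := by
    rw [Real.enorm_of_nonneg (by linarith)]
    exact ENNReal.ofReal_le_one.2 (by linarith)
  calc ∫⁻ ω, ‖a ω - r‖ₑ ^ t ∂μ
      = ENNReal.ofReal r * ‖(1 : ℝ) - r‖ₑ ^ t +
          ENNReal.ofReal (1 - r) * ENNReal.ofReal r ^ t := by
        rw [ha.lintegral_comp (f := fun x => ‖x - r‖ₑ ^ t) (by fun_prop),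
          lintegral_bernoulliMeasure, zero_sub, enorm_neg, Real.enorm_of_nonneg r_nonneg]
    _ ≤ ENNReal.ofReal r * 1 + 1 * ENNReal.ofReal r := by
        gcongr
        · exact ENNReal.rpow_le_one enorm_one_sub (by linarith)
        · exact ENNReal.ofReal_le_one.2 (by linarith)
        · exact ENNReal.rpow_le_self_of_le_one (ENNReal.ofReal_le_one.2 r_le) ht
    _ = 2 * ENNReal.ofReal r := by ring

end Bernoulli

section RandomWeights

/-- Independent centered real weights whose absolute moments of orders `p` and `q` are at most
`w`. -/
structure IsCenteredWeights {Ω ι : Type*} [MeasurableSpace Ω] (μ : Measure Ω) (p q : ℝ) (w : ℝ≥0∞)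
    (b : ι → Ω → ℝ) : Prop where
  indep : iIndepFun b μ
  integrable (i : ι) : Integrable (b i) μ
  integral_eq_zero (i : ι) : ∫ ω, b i ω ∂μ = 0
  lintegral_rpow_le_left (i : ι) : ∫⁻ ω, ‖b i ω‖ₑ ^ p ∂μ ≤ w
  lintegral_rpow_le_right (i : ι) : ∫⁻ ω, ‖b i ω‖ₑ ^ q ∂μ ≤ w

lemma isCenteredWeights_sub_bernoulli {Ω ι : Type*} [MeasurableSpace Ω] {μ : Measure Ω}
    [IsProbabilityMeasure μ] {r : unitInterval} {a : ι → Ω → ℝ} {p q : ℝ}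
    (ha : ∀ i, HasLaw (a i) (bernoulliMeasure (1 : ℝ) 0 r) μ) (hindep : iIndepFun a μ)
    (hp : 1 ≤ p) (hq : 1 ≤ q) :
    IsCenteredWeights μ p q (2 * ENNReal.ofReal r) fun i ω => a i ω - r where
  indep := hindep.comp (fun _ s => s - r) fun _ => by fun_prop
  integrable i := (integrable_of_hasLaw_bernoulliMeasure (ha i)).sub (integrable_const _)
  integral_eq_zero i := by
    rw [integral_sub (integrable_of_hasLaw_bernoulliMeasure (ha i)) (integrable_const _),
      integral_of_hasLaw_bernoulliMeasure (ha i)]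
    simp
  lintegral_rpow_le_left i := lintegral_enorm_sub_rpow_le_of_hasLaw_bernoulliMeasure (ha i) hp
  lintegral_rpow_le_right i := lintegral_enorm_sub_rpow_le_of_hasLaw_bernoulliMeasure (ha i) hq

variable {B : Type*} [NormedAddCommGroup B] [NormedSpace ℝ B] [CompleteSpace B]
  [MeasurableSpace B] [BorelSpace B] [SecondCountableTopology B]
  {p q : ℝ} {Φ : B → ℝ≥0∞} {c w : ℝ≥0∞}
  {Ω : Type*} [MeasurableSpace Ω] {μ : Measure Ω} [IsProbabilityMeasure μ]
  {ι : Type*} [Fintype ι]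

lemma IsPotential.lintegral_enorm_sum_smul_rpow_le (hΦ : IsPotential p q Φ c) (hp : 0 < p)
    (hpq : p ≤ q) {b : ι → Ω → ℝ} (hb : IsCenteredWeights μ p q w b) (x : ι → B) :
    ∫⁻ ω, ‖∑ i, b i ω • x i‖ₑ ^ q ∂μ ≤ rosenthalConst p q c *
      (w ^ (q / p) * (Fintype.card ι : ℝ≥0∞) ^ (q / p - 1) + w) * ∑ i, ‖x i‖ₑ ^ q := by
  have hs : 1 ≤ q / p := (one_le_div hp).2 hpq
  have lintegral_enorm_smul_le : ∀ t : ℝ, 0 ≤ t → ∀ i, ∫⁻ ω, ‖b i ω‖ₑ ^ t ∂μ ≤ w →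
      ∫⁻ ω, ‖b i ω • x i‖ₑ ^ t ∂μ ≤ w * ‖x i‖ₑ ^ t := fun t ht i hle => by
    simp only [enorm_smul, ENNReal.mul_rpow_of_nonneg _ _ ht]
    rw [lintegral_mul_const'' _ ((hb.integrable i).aemeasurable.enorm.pow_const t)]
    gcongr
  have power_mean : (∑ i, ‖x i‖ₑ ^ p) ^ (q / p) ≤
      (Fintype.card ι : ℝ≥0∞) ^ (q / p - 1) * ∑ i, ‖x i‖ₑ ^ q := by
    simpa [← ENNReal.rpow_mul, mul_div_cancel₀ q hp.ne'] using
      ENNReal.rpow_sum_le_const_mul_sum_rpow Finset.univ (fun i => ‖x i‖ₑ ^ p) hs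
  calc ∫⁻ ω, ‖∑ i, b i ω • x i‖ₑ ^ q ∂μ
      ≤ rosenthalConst p q c * ((∑ i, ∫⁻ ω, ‖b i ω • x i‖ₑ ^ p ∂μ) ^ (q / p) +
          ∑ i, ∫⁻ ω, ‖b i ω • x i‖ₑ ^ q ∂μ) :=
        hΦ.lintegral_enorm_sum_rpow_le hp hpq
          (hb.indep.comp (fun i s => s • x i) fun i => by fun_prop)
          (fun i => (hb.integrable i).smul_const _)
          (fun i => (integral_smul_const _ _).trans (by rw [hb.integral_eq_zero, zero_smul]))
          Finset.univ
    _ ≤ rosenthalConst p q c * ((∑ i, w * ‖x i‖ₑ ^ p) ^ (q / p) + ∑ i, w * ‖x i‖ₑ ^ q) := by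
        gcongr with i _ i _
        · exact lintegral_enorm_smul_le p hp.le i (hb.lintegral_rpow_le_left i)
        · exact lintegral_enorm_smul_le q (hp.le.trans hpq) i (hb.lintegral_rpow_le_right i)
    _ = rosenthalConst p q c *
          (w ^ (q / p) * (∑ i, ‖x i‖ₑ ^ p) ^ (q / p) + w * ∑ i, ‖x i‖ₑ ^ q) := by
        rw [← Finset.mul_sum, ← Finset.mul_sum, ENNReal.mul_rpow_of_nonneg _ _ (by linarith)]
    _ ≤ rosenthalConst p q c * (w ^ (q / p) *
          ((Fintype.card ι : ℝ≥0∞) ^ (q / p - 1) * ∑ i, ‖x i‖ₑ ^ q) + w * ∑ i, ‖x i‖ₑ ^ q) := by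
        gcongr
    _ = _ := by ring

lemma IsPotential.lintegral_enorm_sum_smul_comp_rpow_le (hΦ : IsPotential p q Φ c) (hp : 0 < p)
    (hpq : p ≤ q) {b : ι → Ω → ℝ} (hb : IsCenteredWeights μ p q w b)
    {T : Type*} [MeasurableSpace T] {Z : Ω → T} (hZ : AEMeasurable Z μ)
    (hbZ : IndepFun (fun ω i => b i ω) Z μ) {g : ι → T → B} (hg : ∀ i, Measurable (g i)) :
    ∫⁻ ω, ‖∑ i, b i ω • g i (Z ω)‖ₑ ^ q ∂μ ≤ rosenthalConst p q c *
      (w ^ (q / p) * (Fintype.card ι : ℝ≥0∞) ^ (q / p - 1) + w) *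
        ∑ i, ∫⁻ ω, ‖g i (Z ω)‖ₑ ^ q ∂μ := by
  have hF : Measurable (Function.uncurry fun (z : T) (s : ι → ℝ) =>
      ‖∑ i, s i • g i z‖ₑ ^ q) := by
    unfold Function.uncurry
    fun_prop
  calc ∫⁻ ω, ‖∑ i, b i ω • g i (Z ω)‖ₑ ^ q ∂μ
      = ∫⁻ ω, ∫⁻ ω', ‖∑ i, b i ω' • g i (Z ω)‖ₑ ^ q ∂μ ∂μ :=
        lintegral_indepFun_eq hbZ.symm hZ
          (aemeasurable_pi_lambda _ fun i => (hb.integrable i).aemeasurable) hF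
    _ ≤ ∫⁻ ω, rosenthalConst p q c *
          (w ^ (q / p) * (Fintype.card ι : ℝ≥0∞) ^ (q / p - 1) + w) *
            ∑ i, ‖g i (Z ω)‖ₑ ^ q ∂μ :=
        lintegral_mono fun ω =>
          hΦ.lintegral_enorm_sum_smul_rpow_le hp hpq hb fun i => g i (Z ω)
    _ = _ := by
        have : ∀ i, AEMeasurable (fun ω => ‖g i (Z ω)‖ₑ ^ q) μ := fun i =>
          ((hg i).comp_aemeasurable hZ).enorm.pow_const q
        rw [lintegral_const_mul'' _ (by fun_prop), lintegral_finsetSum' _ fun i _ => this i]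

end RandomWeights

section IncompleteUStat

variable {Ω S : Type*} [MeasurableSpace Ω] [MeasurableSpace S] {μ : Measure Ω} {ξ : ℤ → Ω → S}
  [IsProbabilityMeasure μ] {m n : ℕ} {B : Type*} [NormedAddCommGroup B] [MeasurableSpace B]
  [BorelSpace B] {h : (Fin m → S) → B} {p q : ℝ}

lemma IsIID.lintegral_enorm_rpow_comp (hξ : IsIID μ ξ) {κ : Type*} [Fintype κ]
    {h : (κ → S) → B} (hh : Measurable h) {g : κ → ℤ} (hg : Function.Injective g) :
    ∫⁻ ω, ‖h (fun k => ξ (g k) ω)‖ₑ ^ q ∂μ = kernelMoment q (μ.map (ξ 1)) h :=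
  (hξ.measurePreserving_pi hg).lintegral_comp (hh.enorm.pow_const q)

lemma IsIID.lintegral_enorm_rpow_firstVec (hξ : IsIID μ ξ) (hh : Measurable h) :
    ∫⁻ ω, ‖h (firstVec ξ m ω)‖ₑ ^ q ∂μ = kernelMoment q (μ.map (ξ 1)) h :=
  (hξ.measurePreserving_firstVec m).lintegral_comp (hh.enorm.pow_const q)

variable [NormedSpace ℝ B] [SecondCountableTopology B]

lemma IsIID.lintegral_enorm_incompleteUStat_le (hξ : IsIID μ ξ) (hq : 1 ≤ q) (hh : Measurable h)
    (a : Inc m n → Ω → ℝ) (r : ℝ) :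
    ∫⁻ ω, ‖incompleteUStat a ξ h ω‖ₑ ^ q ∂μ ≤ 2 ^ (q - 1) *
      (‖r‖ₑ ^ q * kernelMoment q (μ.map (ξ 1)) (kernelSum m n h) +
        ∫⁻ ω, ‖incompleteUStat (fun i ω => a i ω - r) ξ h ω‖ₑ ^ q ∂μ) := by
  have hq0 : 0 ≤ q := by linarith
  have hsum := measurable_kernelSum (n := n) hh
  have lintegral_smul : ∫⁻ ω, ‖r • kernelSum m n h (firstVec ξ n ω)‖ₑ ^ q ∂μ =
      ‖r‖ₑ ^ q * kernelMoment q (μ.map (ξ 1)) (kernelSum m n h) := by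
    simp only [enorm_smul, ENNReal.mul_rpow_of_nonneg _ _ hq0]
    rw [lintegral_const_mul' _ _ (ENNReal.rpow_ne_top_of_nonneg hq0 enorm_ne_top),
      hξ.lintegral_enorm_rpow_firstVec hsum]
  have hmeas : Measurable fun ω => ‖r • kernelSum m n h (firstVec ξ n ω)‖ₑ ^ q :=
    ((hsum.comp (hξ.measurable_firstVec n)).const_smul r).enorm.pow_const q
  rw [← lintegral_smul, ← lintegral_add_left hmeas, ← lintegral_const_mul' _ _ (by finiteness)]
  refine lintegral_mono fun ω => ?_
  rw [incompleteUStat_eq_smul_kernelSum_add a ξ h r]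
  exact enorm_add_rpow_le hq _ _

variable [CompleteSpace B] {Φ : B → ℝ≥0∞} {c w : ℝ≥0∞}

/- Given `ξ`, this is a sum of fixed vectors with independent centered weights. -/
lemma IsPotential.lintegral_enorm_incompleteUStat_centered_le (hΦ : IsPotential p q Φ c)
    (hp : 0 < p) (hpq : p ≤ q) (hξ : IsIID μ ξ) (hh : Measurable h) {b : Inc m n → Ω → ℝ}
    (hb : IsCenteredWeights μ p q w b)
    (hbξ : IndepFun (fun ω i => b i ω) (fun ω (j : {j : ℤ // 1 ≤ j}) => ξ j ω) μ) :
    ∫⁻ ω, ‖incompleteUStat b ξ h ω‖ₑ ^ q ∂μ ≤ rosenthalConst p q c *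
      (w ^ (q / p) * n ^ (m * q / p) + w * n ^ m) * kernelMoment q (μ.map (ξ 1)) h := by
  have hs : 1 ≤ q / p := (one_le_div hp).2 hpq
  set N := (Fintype.card (Inc m n) : ℝ≥0∞)
  have card_le : N ≤ n ^ m := by
    simpa [N] using mod_cast card_Inc_le m n
  have card_rpow_le : N ^ (q / p - 1) * N ≤ n ^ (m * q / p) := by
    calc N ^ (q / p - 1) * N = N ^ (q / p - 1) * N ^ (1 : ℝ) := by rw [ENNReal.rpow_one]
      _ = N ^ (q / p) := by
          rw [← ENNReal.rpow_add_of_nonneg _ _ (by linarith) zero_le_one, sub_add_cancel]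
      _ ≤ (n ^ m) ^ (q / p) := by gcongr
      _ = n ^ (m * q / p) := by
          rw [← ENNReal.rpow_natCast, ← ENNReal.rpow_mul, mul_div_assoc]
  calc ∫⁻ ω, ‖incompleteUStat b ξ h ω‖ₑ ^ q ∂μ
      ≤ rosenthalConst p q c * (w ^ (q / p) * N ^ (q / p - 1) + w) *
          ∑ i : Inc m n, ∫⁻ ω, ‖h fun k => ξ (i.1 k) ω‖ₑ ^ q ∂μ :=
        hΦ.lintegral_enorm_sum_smul_comp_rpow_le hp hpq hb
          (measurable_pi_lambda _ fun _ => hξ.1 _).aemeasurable hbξ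
          (g := fun i z => h fun k => z ⟨i.1 k, (Finset.mem_Icc.1 (mem_Icc_of_mem_Inc i.2 k)).1⟩)
          fun i => hh.comp (measurable_pi_lambda _ fun _ => measurable_pi_apply _)
    _ = rosenthalConst p q c * (w ^ (q / p) * (N ^ (q / p - 1) * N) + w * N) *
          kernelMoment q (μ.map (ξ 1)) h := by
        simp only [fun i : Inc m n =>
          hξ.lintegral_enorm_rpow_comp (q := q) hh (strictMono_of_mem_Inc i.2).injective]
        rw [Finset.sum_const, Finset.card_univ, nsmul_eq_mul]
        ring
    _ ≤ _ := by gcongr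

/-- The constant in the moment bound for incomplete `U`-statistics of `m` arguments. -/
noncomputable def incompleteUStatConst (p q : ℝ) (m : ℕ) (c : ℝ≥0∞) : ℝ≥0∞ :=
  2 ^ (q - 1) * (kernelSumConst p q c ^ m + rosenthalConst p q c * 2 ^ (q / p))

lemma incompleteUStatConst_ne_zero (hq : 1 ≤ q) : incompleteUStatConst p q m c ≠ 0 := by
  have := (zero_lt_one.trans_le (one_le_kernelSumConst (p := p) (c := c) hq)).ne'
  have := (ENNReal.rpow_pos (p := q - 1) two_pos ENNReal.ofNat_ne_top).ne'
  simp_all [incompleteUStatConst]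

lemma incompleteUStatConst_ne_top (hp : 0 ≤ p) (hq : 1 ≤ q) (hc : c ≠ ∞) :
    incompleteUStatConst p q m c ≠ ∞ := by
  have := kernelSumConst_ne_top hp hq hc
  have := rosenthalConst_ne_top hp (by linarith : 0 ≤ q) hc
  unfold incompleteUStatConst
  finiteness

lemma IsPotential.lintegral_enorm_incompleteUStat_sub_bernoulli_le (hΦ : IsPotential p q Φ c)
    (hp : 1 ≤ p) (hpq : p ≤ q) (hξ : IsIID μ ξ) (hh : Measurable h) {r : unitInterval}
    {a : Inc m n → Ω → ℝ} (ha : ∀ i, HasLaw (a i) (bernoulliMeasure (1 : ℝ) 0 r) μ)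
    (hindep : iIndepFun a μ)
    (haξ : IndepFun (fun ω i => a i ω) (fun ω (j : {j : ℤ // 1 ≤ j}) => ξ j ω) μ) :
    ∫⁻ ω, ‖incompleteUStat (fun i ω => a i ω - r) ξ h ω‖ₑ ^ q ∂μ ≤
      rosenthalConst p q c * 2 ^ (q / p) *
        (n ^ (m * q / p) * ENNReal.ofReal r ^ (q / p) + n ^ m * ENNReal.ofReal r) *
        kernelMoment q (μ.map (ξ 1)) h := by
  have hp0 : 0 < p := by linarith
  have hs : 1 ≤ q / p := (one_le_div hp0).2 hpq
  have two_le : (2 : ℝ≥0∞) ≤ 2 ^ (q / p) := ENNReal.le_rpow_self_of_one_le one_le_two hs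
  set s := ENNReal.ofReal r
  calc ∫⁻ ω, ‖incompleteUStat (fun i ω => a i ω - r) ξ h ω‖ₑ ^ q ∂μ
      ≤ rosenthalConst p q c * ((2 * s) ^ (q / p) * n ^ (m * q / p) + 2 * s * n ^ m) *
          kernelMoment q (μ.map (ξ 1)) h :=
        hΦ.lintegral_enorm_incompleteUStat_centered_le hp0 hpq hξ hh
          (isCenteredWeights_sub_bernoulli ha hindep hp (hp.trans hpq))
          (haξ.comp (φ := fun s i => s i - (r : ℝ)) (by fun_prop) measurable_id)
    _ ≤ rosenthalConst p q c * (2 ^ (q / p) * s ^ (q / p) * n ^ (m * q / p) +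
          2 ^ (q / p) * s * n ^ m) * kernelMoment q (μ.map (ξ 1)) h := by
        rw [ENNReal.mul_rpow_of_nonneg _ _ (by linarith)]
        gcongr
    _ = _ := by ring

lemma IsPotential.lintegral_enorm_incompleteUStat_bernoulli_le (hΦ : IsPotential p q Φ c)
    (hp : 1 ≤ p) (hpq : p ≤ q) (hξ : IsIID μ ξ) (hh : Measurable h) {d : ℕ}
    (hd : IsDegenerateKernel (μ.map (ξ 1)) d h) (hn : n ≠ 0) {r : unitInterval}
    {a : Inc m n → Ω → ℝ} (ha : ∀ i, HasLaw (a i) (bernoulliMeasure (1 : ℝ) 0 r) μ)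
    (hindep : iIndepFun a μ)
    (haξ : IndepFun (fun ω i => a i ω) (fun ω (j : {j : ℤ // 1 ≤ j}) => ξ j ω) μ) :
    ∫⁻ ω, ‖incompleteUStat a ξ h ω‖ₑ ^ q ∂μ ≤ incompleteUStatConst p q m c *
      (n ^ kernelExponent p q m d * ENNReal.ofReal r ^ q +
        n ^ (m * q / p) * ENNReal.ofReal r ^ (q / p) + n ^ m * ENNReal.ofReal r) *
      ∫⁻ ω, ‖h (firstVec ξ m ω)‖ₑ ^ q ∂μ := by
  have := hξ.isProbabilityMeasure_map 1
  have hq : 1 ≤ q := hp.trans hpq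
  have centered_le := hΦ.lintegral_enorm_incompleteUStat_sub_bernoulli_le hp hpq hξ hh ha hindep haξ
  have kernelSum_le := hΦ.kernelMoment_kernelSum_le (by linarith) hpq hq hh hd hn le_rfl
  rw [hξ.lintegral_enorm_rpow_firstVec hh, incompleteUStatConst, add_assoc (_ * _)]
  set L := kernelMoment q (μ.map (ξ 1)) h
  set K := kernelSumConst p q c ^ m
  set R := rosenthalConst p q c * 2 ^ (q / p)
  set s := ENNReal.ofReal r
  set T := (n : ℝ≥0∞) ^ (m * q / p) * s ^ (q / p) + n ^ m * s
  set T₀ := (n : ℝ≥0∞) ^ kernelExponent p q m d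
  calc ∫⁻ ω, ‖incompleteUStat a ξ h ω‖ₑ ^ q ∂μ
      ≤ 2 ^ (q - 1) * (s ^ q * (K * T₀ * L) + R * T * L) := by
        refine (hξ.lintegral_enorm_incompleteUStat_le hq hh a r).trans ?_
        rw [Real.enorm_of_nonneg r.2.1]
        gcongr
    _ = 2 ^ (q - 1) * (K * (T₀ * s ^ q) + R * T) * L := by ring
    _ ≤ 2 ^ (q - 1) * (K * (T₀ * s ^ q + T) + R * (T₀ * s ^ q + T)) * L := by
        gcongr
        · exact le_self_add
        · exact le_add_self
    _ = _ := by ring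

lemma ofReal_toReal_mul_sum_rpow {C : ℝ≥0∞} (hC : C ≠ ∞) {n : ℕ} (hn : n ≠ 0) {x : ℝ}
    (hx : 0 ≤ x) {u v : ℝ} (hu : 0 ≤ u) (hv : 0 ≤ v) (s t : ℝ) (m : ℕ) :
    ENNReal.ofReal (C.toReal * ((n : ℝ) ^ s * x ^ u + (n : ℝ) ^ t * x ^ v + (n : ℝ) ^ m * x)) =
      C * (n ^ s * ENNReal.ofReal x ^ u + n ^ t * ENNReal.ofReal x ^ v +
        n ^ m * ENNReal.ofReal x) := by
  have hn0 : (0 : ℝ) < n := by exact_mod_cast hn.bot_lt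
  rw [ENNReal.ofReal_mul ENNReal.toReal_nonneg, ENNReal.ofReal_toReal hC,
    ENNReal.ofReal_add (by positivity) (by positivity),
    ENNReal.ofReal_add (by positivity) (by positivity), ENNReal.ofReal_mul (by positivity),
    ENNReal.ofReal_mul (by positivity), ENNReal.ofReal_mul (by positivity),
    ENNReal.ofReal_rpow_of_nonneg hx hu, ENNReal.ofReal_rpow_of_nonneg hx hv,
    ← ENNReal.ofReal_rpow_of_pos hn0, ← ENNReal.ofReal_rpow_of_pos hn0,
    ENNReal.ofReal_pow hn0.le, ENNReal.ofReal_natCast]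

end IncompleteUStat

end IncompleteUStat

theorem mainTheorem8_general
    {B : Type*} [NormedAddCommGroup B] [NormedSpace ℝ B] [CompleteSpace B]
    [TopologicalSpace.SeparableSpace B] [MeasurableSpace B] [BorelSpace B]
    (m : ℕ) (hm : m ≠ 0) (p q : ℝ) (hp : 1 < p) (hpq : p ≤ q) :
    ∃ C : ℝ, 0 < C ∧
      ∀ (r : ℝ), p ≤ r → r ≤ 2 → IncompleteUStat.IsSmoothSpace r B →
      ∀ {Ω S : Type*} [MeasurableSpace Ω] [MeasurableSpace S]
        (μ : Measure Ω) [IsProbabilityMeasure μ]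
        (ξ : ℤ → Ω → S), IncompleteUStat.IsIID μ ξ →
      ∀ (h : (Fin m → S) → B), Measurable h →
      ∀ (d : ℕ), IncompleteUStat.IsDegenerateKernel (μ.map (ξ 1)) d h →
      ∀ (n : ℕ) (pn : unitInterval) (a : IncompleteUStat.Inc m n → Ω → ℝ),
        (∀ i, HasLaw (a i) (bernoulliMeasure (1 : ℝ) 0 pn) μ) →
        iIndepFun a μ →
        IndepFun (fun ω i => a i ω) (fun ω (j : {j : ℤ // 1 ≤ j}) => ξ j ω) μ →
        ∫⁻ ω, ‖IncompleteUStat.incompleteUStat a ξ h ω‖ₑ ^ q ∂μ ≤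
          ENNReal.ofReal
            (C * ((n : ℝ) ^ (q * ((m : ℝ) - d) + d * q / p) * (pn : ℝ) ^ q
              + (n : ℝ) ^ (m * q / p) * (pn : ℝ) ^ (q / p)
              + (n : ℝ) ^ m * (pn : ℝ)))
          * ∫⁻ ω, ‖h (IncompleteUStat.firstVec ξ m ω)‖ₑ ^ q ∂μ := by
  have : SecondCountableTopology B := UniformSpace.secondCountable_of_separable B
  have hq : 1 ≤ q := by linarith
  by_cases hB : ∃ r : ℝ, p ≤ r ∧ r ≤ 2 ∧ IncompleteUStat.IsSmoothSpace r B
  swap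
  · exact ⟨1, one_pos, fun r hpr hr hsmooth => absurd ⟨r, hpr, hr, hsmooth⟩ hB⟩
  obtain ⟨r, hpr, hr, hsmooth⟩ := hB
  obtain ⟨Φ, c, hΦ⟩ := hsmooth.exists_isPotential hp hpr hr hpq
  have C_ne_top : IncompleteUStat.incompleteUStatConst p q m c ≠ ⊤ :=
    IncompleteUStat.incompleteUStatConst_ne_top (by linarith) hq hΦ.ne_top
  refine ⟨(IncompleteUStat.incompleteUStatConst p q m c).toReal,
    ENNReal.toReal_pos (IncompleteUStat.incompleteUStatConst_ne_zero hq) C_ne_top, ?_⟩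
  intro _ _ _ _ Ω S _ _ μ _ ξ hξ h hh d hd n pn a ha hindep haξ
  rcases eq_or_ne n 0 with rfl | hn
  · have := IncompleteUStat.isEmpty_Inc_zero hm
    simp [IncompleteUStat.incompleteUStat, ENNReal.zero_rpow_of_pos (by linarith : 0 < q)]
  rw [IncompleteUStat.ofReal_toReal_mul_sum_rpow C_ne_top hn pn.2.1 (by linarith)
    (div_nonneg (by linarith) (by linarith))]
  exact hΦ.lintegral_enorm_incompleteUStat_bernoulli_le hp.le hpq hξ hh hd hn ha hindep haξ

theorem mainTheorem8
    {B : Type*} [NormedAddCommGroup B] [NormedSpace ℝ B] [CompleteSpace B]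
    [TopologicalSpace.SeparableSpace B] [MeasurableSpace B] [BorelSpace B]
    (m : ℕ) (hm : 2 ≤ m) (p q : ℝ) (hp : 1 < p) (hpq : p ≤ q) :
    ∃ C : ℝ, 0 < C ∧
      ∀ (r : ℝ), p ≤ r → r ≤ 2 → IncompleteUStat.IsSmoothSpace r B →
      ∀ {Ω S : Type*} [MeasurableSpace Ω] [MeasurableSpace S]
        (μ : Measure Ω) [IsProbabilityMeasure μ]
        (ξ : ℤ → Ω → S), IncompleteUStat.IsIID μ ξ →
      ∀ (h : (Fin m → S) → B), Measurable h → IncompleteUStat.IsSymmKernel h →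
      ∀ (d : ℕ), 1 ≤ d → d ≤ m → IncompleteUStat.IsDegenerateOfOrder μ ξ h d →
      ∀ (n : ℕ) (pn : unitInterval) (a : IncompleteUStat.Inc m n → Ω → ℝ),
        (∀ i, HasLaw (a i) (bernoulliMeasure (1 : ℝ) 0 pn) μ) →
        iIndepFun a μ →
        IndepFun (fun ω i => a i ω) (fun ω (j : {j : ℤ // 1 ≤ j}) => ξ j ω) μ →
        ∫⁻ ω, ‖IncompleteUStat.incompleteUStat a ξ h ω‖ₑ ^ q ∂μ ≤
          ENNReal.ofReal
            (C * ((n : ℝ) ^ (q * ((m : ℝ) - d) + d * q / p) * (pn : ℝ) ^ q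
              + (n : ℝ) ^ (m * q / p) * (pn : ℝ) ^ (q / p)
              + (n : ℝ) ^ m * (pn : ℝ)))
          * ∫⁻ ω, ‖h (IncompleteUStat.firstVec ξ m ω)‖ₑ ^ q ∂μ := by
  have : SecondCountableTopology B := UniformSpace.secondCountable_of_separable B
  obtain ⟨C, hC, moment_le⟩ := mainTheorem8_general (B := B) m (by lia) p q hp hpq
  exact ⟨C, hC, fun r hpr hr hB _ _ _ _ μ _ ξ hξ h hh hsymm d _ _ hdeg =>
    moment_le r hpr hr hB μ ξ hξ h hh d (hξ.isDegenerateKernel hh hsymm hdeg)⟩
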